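/- Consider a discrete memoryless relay channel with orthogonal components and an external interferer: finite alphabets, transition pmfs $P_{Y_R|X_{SR}X_R}$ (source to relay) and $P_{Y_D|X_{SD}X_RX_I}$ (to the destination), where $Y_D=(Y_{D_1},Y_{D_2})$ and $$P_{Y_D|X_{SD}X_RX_I}=P_{Y_{D_1}|X_{SD}}\cdot P_{Y_{D_2}|X_RX_I},$$ so that the interference affects the R–D link only. For every block length $n$ the interferer uses a fixed codebook, known to all nodes, and sends the codeword $X_I^n(W_I)$ of a uniformly distributed message $W_I$. The source knows $W_I$ in advance and sends a uniformly distributed message $W$, independent of $W_I$, from a set of $\lceil 2^{nR}\rceil$ messages: $(X_{SD}^n,X_{SR}^n)$ is a function of $(W,W_I)$, the relay input $X_{R,i}$ is a function of $Y_R^{i-1}$, and the destination estimates $W$ from $Y_D^n$ alone. A rate $R\ge 0$ is achievable if there are such codes with average error probability tending to $0$ as $n\to\infty$, and the capacity $C$ is the supremum of the achievable rates. Then $$C=C_{SD}+C_{SRD},$$ where $C_{SD}=\max_{P_{X_{SD}}}I(X_{SD};Y_{D_1})$ is the capacity of the S–D link and $C_{SRD}$ is the capacity of the multihop link S–R–D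 alone (the same model without $X_{SD}$ and $Y_{D_1}$). In multiletter form, $C_{SRD}$ is the supremum of the numbers $r$ for which there are, for every $n$, a finite-valued random variable $U_n$ independent of $W_I$, an input $X_{SR}^n$ that is a function of $(U_n,W_I)$, and relay functions $X_{R,i}$ of $Y_R^{i-1}$, such that for every $\varepsilon>0$ $$\Pr\Big[\tfrac1n\log_2\frac{P_{U_nY_{D_2}^n}(U_n,Y_{D_2}^n)}{P_{U_n}(U_n)\,P_{Y_{D_2}^n}(Y_{D_2}^n)}<r-\varepsilon\Big]\longrightarrow 0\qquad(n\to\infty).$$ Moreover, $C$ is achieved by independent signalling on the two links, with the S–D signal independent of the interference: $C$ is also the supremum of the sums $R_1+R_2$, $R_1,R_2\ge0$, for which there are codes with error probability tending to $0$ in which $W=(W',W'')$ with $\lceil 2^{nR_1}\rceil$ and $\lceil 2^{nR_2}\rceil$ values respectively, $X_{SD}^n$ is a function of $W'$ only, $X_{SR}^n$ is a function of $(W'',W_I)$, $W'$ is decoded from $Y_{D_1}^n$ and $W''$ from $Y_{D_2}^n$. -/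

import Mathlib

namespace OrthRelay

/-- Discrete memoryless relay channel with orthogonal components and an external interferer:
the transition pmfs `P_{Y_R | X_SR, X_R}` and `P_{Y_D | X_SD, X_R, X_I}`. -/
structure RelayChannel (XSD XSR XR XI YR YD : Type*) [Fintype YR] [Fintype YD] where
  toRelay : XSR → XR → stdSimplex ℝ YR
  toDest : XSD → XR → XI → stdSimplex ℝ YD

/-- The fixed codebooks of the interferer, one for every block length `n`; the interferer's message
is uniform on `Fin (size n)`. A codebook of rate `R_I` has `size n = 2 ^ (n * R_I)`, rounded to an
integer; no restriction on the sizes is needed. -/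
structure InterfererCodebook (XI : Type*) where
  size : ℕ → ℕ
  size_pos : ∀ n, 0 < size n
  codeword : ∀ n, Fin (size n) → Fin n → XI

/-- The strictly causal past `(y_1, …, y_{i-1})` of a sequence at time `i`. -/
def past {Y : Type*} {n : ℕ} (y : Fin n → Y) (i : Fin n) : Fin i → Y :=
  fun j => y (Fin.castLE i.isLt.le j)

/-- Transmission strategy for block length `n`, when the source holds an element of `M` and knows the
interferer's message (one of `K`) in advance. The relay input at time `i` is a
function of what the relay received before time `i`. -/
structure Strategy (XSD XSR XR YR M : Type*) (K n : ℕ) where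
  encSD : M → Fin K → Fin n → XSD
  encSR : M → Fin K → Fin n → XSR
  relay : (i : Fin n) → (Fin i → YR) → XR

/-- A code for the message set `M`: a transmission strategy and a decoder at the destination. -/
structure Code (XSD XSR XR YR YD M : Type*) (K n : ℕ) extends Strategy XSD XSR XR YR M K n where
  dec : (Fin n → YD) → M

/-- Independent signalling on the two links: the message is a pair; the S-D signal is a function of
the first component alone (and not of the interference), the S-R signal a function of the second
component and of the interferer's message, and each component is decoded from the output
of its own link. -/
def Code.IsIndependentSignalling {XSD XSR XR YR YD₁ YD₂ M₁ M₂ : Type*} {K n : ℕ}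
    (c : Code XSD XSR XR YR (YD₁ × YD₂) (M₁ × M₂) K n) : Prop :=
  ∃ (f : M₁ → Fin n → XSD) (g : M₂ → Fin K → Fin n → XSR)
    (d₁ : (Fin n → YD₁) → M₁) (d₂ : (Fin n → YD₂) → M₂),
    (∀ w wI, c.encSD w wI = f w.1) ∧ (∀ w wI, c.encSR w wI = g w.2 wI) ∧
    ∀ y, c.dec y = (d₁ (fun i => (y i).1), d₂ (fun i => (y i).2))

/-- Information density (in bits) of a joint pmf `J` on `A × B`. -/
noncomputable def infoDensity {A B : Type*} [Fintype A] [Fintype B] (J : A → B → ℝ)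
    (a : A) (b : B) : ℝ :=
  Real.logb 2 (J a b / ((∑ b', J a b') * ∑ a', J a' b))

/-- Mutual information (in bits) of a joint pmf `J` on `A × B`. -/
noncomputable def mutualInfo {A B : Type*} [Fintype A] [Fintype B] (J : A → B → ℝ) : ℝ :=
  ∑ a, ∑ b, J a b * infoDensity J a b

/-- `2 ^ (n R)`, rounded up: the number of messages at block length `n` and rate `R`. -/
noncomputable def numMessages (n : ℕ) (R : ℝ) : ℕ := ⌈(2 : ℝ) ^ ((n : ℝ) * R)⌉₊

namespace RelayChannel

variable {XSD XSR XR XI YR YD YD₁ YD₂ M : Type*}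
variable [Fintype YR] [Fintype YD] [Fintype YD₁] [Fintype YD₂]

/-- Probability of the output sequence `yD` at the destination, given the input sequences of the
source, the interferer's codeword and the relay functions. -/
noncomputable def destProb (P : RelayChannel XSD XSR XR XI YR YD) {n : ℕ}
    (xSD : Fin n → XSD) (xSR : Fin n → XSR) (relay : (i : Fin n) → (Fin i → YR) → XR)
    (xI : Fin n → XI) (yD : Fin n → YD) : ℝ :=
  ∑ yR : Fin n → YR, ∏ i,
    (P.toRelay (xSR i) (relay i (past yR i))).1 (yR i) *
      (P.toDest (xSD i) (relay i (past yR i)) (xI i)).1 (yD i)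

/-- `P_{Y_D^n | M}`: the output law when the source holds `m` and the interferer's message is
uniform (and independent of `m`). -/
noncomputable def outputLaw (P : RelayChannel XSD XSR XR XI YR YD) (J : InterfererCodebook XI)
    {n : ℕ} (s : Strategy XSD XSR XR YR M (J.size n) n) (m : M) (yD : Fin n → YD) : ℝ :=
  (J.size n : ℝ)⁻¹ *
    ∑ wI, P.destProb (s.encSD m wI) (s.encSR m wI) s.relay (J.codeword n wI) yD

/-- Average probability of error of a code, for a uniform message. -/
noncomputable def errorProb (P : RelayChannel XSD XSR XR XI YR YD) (J : InterfererCodebook XI)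
    [Fintype M] [DecidableEq M] {n : ℕ} (c : Code XSD XSR XR YR YD M (J.size n) n) : ℝ :=
  (Fintype.card M : ℝ)⁻¹ *
    ∑ m, ∑ yD, if c.dec yD = m then 0 else P.outputLaw J c.toStrategy m yD

/-- The rate `R` (bits per channel use) is achievable. -/
def Achievable (P : RelayChannel XSD XSR XR XI YR YD) (J : InterfererCodebook XI) (R : ℝ) : Prop :=
  0 ≤ R ∧ ∃ c : ∀ n, Code XSD XSR XR YR YD (Fin (numMessages n R)) (J.size n) n,
    Filter.Tendsto (fun n => P.errorProb J (c n)) Filter.atTop (nhds 0)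

/-- The rates `R₁` on the S-D link and `R₂` on the S-R-D link are achievable together
by independent signalling on the two links. -/
def IndependentlyAchievable (P : RelayChannel XSD XSR XR XI YR (YD₁ × YD₂))
    (J : InterfererCodebook XI) (R₁ R₂ : ℝ) : Prop :=
  0 ≤ R₁ ∧ 0 ≤ R₂ ∧
    ∃ c : ∀ n, Code XSD XSR XR YR (YD₁ × YD₂)
      (Fin (numMessages n R₁) × Fin (numMessages n R₂)) (J.size n) n,
      (∀ n, (c n).IsIndependentSignalling) ∧
      Filter.Tendsto (fun n => P.errorProb J (c n)) Filter.atTop (nhds 0)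

/-- Joint pmf of `(U, Y_D^n)` when the source holds `U ~ q`, independent of the interference. -/
noncomputable def jointLaw (P : RelayChannel XSD XSR XR XI YR YD) (J : InterfererCodebook XI)
    {n : ℕ} [Fintype M] (q : stdSimplex ℝ M) (s : Strategy XSD XSR XR YR M (J.size n) n)
    (u : M) (yD : Fin n → YD) : ℝ :=
  q.1 u * P.outputLaw J s u yD

open Classical in
/-- `r` is a multiletter information rate: for some inputs `U_n` (finite-valued, independent of the
interference) and transmission strategies, one for every `n`, the normalized information density
`i(U_n; Y_D^n) / n` is asymptotically at least `r` in probability. -/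
def IsInformationRate (P : RelayChannel XSD XSR XR XI YR YD) (J : InterfererCodebook XI)
    (r : ℝ) : Prop :=
  ∃ (k : ℕ → ℕ) (q : ∀ n, stdSimplex ℝ (Fin (k n)))
    (s : ∀ n, Strategy XSD XSR XR YR (Fin (k n)) (J.size n) n),
    ∀ ε : ℝ, 0 < ε → Filter.Tendsto
      (fun n => ∑ u, ∑ yD : Fin n → YD,
        if infoDensity (P.jointLaw J (q n) (s n)) u yD < n * (r - ε)
          then P.jointLaw J (q n) (s n) u yD else 0)
      Filter.atTop (nhds 0)

/-- The multihop link S-R-D alone (no direct S-D link: the S-D input is trivial). -/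
def multihop (PR : XSR → XR → stdSimplex ℝ YR) (P₂ : XR → XI → stdSimplex ℝ YD₂) :
    RelayChannel Unit XSR XR XI YR YD₂ where
  toRelay := PR
  toDest := fun _ => P₂

end RelayChannel

end OrthRelay

/-! The proof uses information spectra. A code of rate `R` with vanishing error forces the
likelihood ratio of its output to exceed `2 ^ (n (R - ε))` with high probability (Verdú–Han,
`spectrumBelow_uniform_le`). Conversely, such a bound on the ratio yields codes (Feinstein,
`feinstein`). On the S-R-D link alone the two match, so the operational and multiletter values of
`C_SRD` agree without any single-letter formula.

Direct part: Feinstein codes are used on each link separately. As the S-D signal ignores the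
interference, the two outputs are independent given the message pair, and the error probabilities
add.

Converse: the source may let the S-D signal depend on `W_I`, so `Y_D1` and `Y_D2` need not be
independent given `W`; they are independent given `(W, W_I)`. The core is
`spectrumBelow_marginal_le`: dropping `Y_D1` costs the likelihood ratio at most a factor `S / δ ^
2`, where `S` bounds the ratio of `Y_D1`, given message and interference, to a fixed law `Q`. Two
Markov bounds, each of probability `δ`, replace the joint laws by products. Take `Q` to be the power
of the output law of a capacity-achieving input. The Kuhn–Tucker conditions bound every divergence
from it by `C_SD`, so by Chebyshev `S = 2 ^ (n (C_SD + ε))` works for every input sequence, however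
it was chosen. With `δ = 2 ^ (-n ε)` the information rate `R - C_SD` is left to the S-R-D link,
hence `R - C_SD ≤ C_SRD`. -/

namespace OrthRelay

open Finset Filter

/-! ### One-shot coding bounds: Feinstein and Verdú–Han -/

section Channel

variable {U Y : Type*} [Fintype U] [Fintype Y]

/-- Transition probabilities of a channel with finite output alphabet. -/
structure IsChannel {U Y : Type*} [Fintype Y] (W : U → Y → ℝ) : Prop where
  nonneg : ∀ u y, 0 ≤ W u y
  sum_eq_one : ∀ u, ∑ y, W u y = 1

/-- Output law of a channel for the input law `q`. -/
noncomputable def outLaw (W : U → Y → ℝ) (q : U → ℝ) (y : Y) : ℝ := ∑ u, q u * W u y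

/-- Probability that the likelihood ratio `W (y | u) / P_Y y` is below `T`. -/
noncomputable def spectrumBelow (W : U → Y → ℝ) (q : U → ℝ) (T : ℝ) : ℝ :=
  ∑ u, ∑ y, if W u y < T * outLaw W q y then q u * W u y else 0

theorem outLaw_nonneg {W : U → Y → ℝ} (hW : IsChannel W) {q : U → ℝ} (hq : q ∈ stdSimplex ℝ U)
    (y : Y) : 0 ≤ outLaw W q y :=
  sum_nonneg fun u _ => mul_nonneg (hq.1 u) (hW.nonneg u y)

theorem sum_outLaw {W : U → Y → ℝ} (hW : IsChannel W) {q : U → ℝ} (hq : q ∈ stdSimplex ℝ U) :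
    ∑ y, outLaw W q y = 1 := by
  unfold outLaw
  rw [sum_comm]
  simp_rw [← mul_sum, hW.sum_eq_one, mul_one]
  exact hq.2

theorem spectrumBelow_nonneg {W : U → Y → ℝ} (hW : IsChannel W) {q : U → ℝ}
    (hq : q ∈ stdSimplex ℝ U) (T : ℝ) : 0 ≤ spectrumBelow W q T := by
  refine sum_nonneg fun u _ => sum_nonneg fun y _ => ?_
  split_ifs
  · exact mul_nonneg (hq.1 u) (hW.nonneg u y)
  · exact le_rfl

theorem exists_le_of_sum_mul_le {q : U → ℝ} (hq : q ∈ stdSimplex ℝ U) {g : U → ℝ} {e : ℝ}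
    (h : ∑ u, q u * g u ≤ e) : ∃ u, g u ≤ e := by
  by_contra! hc
  have h1 : ∑ u, q u * e ≤ ∑ u, q u * g u :=
    sum_le_sum fun u _ => mul_le_mul_of_nonneg_left (hc u).le (hq.1 u)
  rw [← sum_mul, hq.2, one_mul] at h1
  have h2 : ∑ u, q u * (g u - e) = 0 := by
    simp_rw [mul_sub]
    rw [sum_sub_distrib, ← sum_mul, hq.2]
    linarith
  rw [sum_eq_zero_iff_of_nonneg
    fun u _ => mul_nonneg (hq.1 u) (sub_nonneg.2 (hc u).le)] at h2
  have h3 : ∑ u, q u = 0 := sum_eq_zero fun u hu => by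
    rcases mul_eq_zero.1 (h2 u hu) with h | h
    · exact h
    · linarith [hc u]
  linarith [hq.2]

-- Greedy construction of the code. Each decoding set lies where `outLaw ≤ W / T`, so it has output
-- mass at most `1 / T`. While at most `M` sets are used, a codeword drawn from `q` therefore still
-- has small average error on the unclaimed outputs.
open Classical in
theorem feinstein_aux {W : U → Y → ℝ} (hW : IsChannel W) {q : U → ℝ} (hq : q ∈ stdSimplex ℝ U)
    {T : ℝ} (hT : 0 < T) (M : ℕ) (N : ℕ) (hN : N ≤ M) :
    ∃ (enc : ℕ → U) (dec : Y → ℕ),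
      (∀ m < N, ∑ y, (if dec y = m then 0 else W (enc m) y) ≤ spectrumBelow W q T + M / T) ∧
      ∑ y, (if dec y < N then outLaw W q y else 0) ≤ N / T := by
  induction N with
  | zero =>
    have : Nonempty U := by
      by_contra h
      rw [not_nonempty_iff] at h
      simpa using hq.2
    exact ⟨fun _ => Classical.arbitrary U, fun _ => 0, by simp, by simp⟩
  | succ N ih =>
    obtain ⟨enc, dec, herr, hmass⟩ := ih (by omega)
    -- Under `q`, the candidate fails if its ratio is below `T` or its output is already claimed;
    -- the latter has probability at most `N / T`. Some `u` does no worse than the average.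
    obtain ⟨u, hu⟩ : ∃ u, ∑ y, (if ¬ dec y < N ∧ T * outLaw W q y ≤ W u y then 0 else W u y) ≤
        spectrumBelow W q T + M / T := by
      apply exists_le_of_sum_mul_le hq
      calc ∑ u, q u * ∑ y, (if ¬ dec y < N ∧ T * outLaw W q y ≤ W u y then 0 else W u y)
          ≤ ∑ u, ∑ y, ((if W u y < T * outLaw W q y then q u * W u y else 0) +
              (if dec y < N then q u * W u y else 0)) := by
            refine sum_le_sum fun u _ => ?_
            rw [mul_sum]
            refine sum_le_sum fun y _ => ?_
            have := mul_nonneg (hq.1 u) (hW.nonneg u y)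
            split_ifs <;> grind
        _ = spectrumBelow W q T + ∑ y, (if dec y < N then outLaw W q y else 0) := by
            simp_rw [sum_add_distrib]
            congr 1
            rw [sum_comm]
            refine sum_congr rfl fun y _ => ?_
            split_ifs
            · rfl
            · simp
        _ ≤ _ := by
            have : (N : ℝ) / T ≤ M / T := by gcongr; omega
            linarith
    -- The value `N + 1` marks an output as unclaimed by the messages `0, …, N`, leaving it free for
    -- the next codeword.
    refine ⟨Function.update enc N u,
      fun y => if dec y < N then dec y else if T * outLaw W q y ≤ W u y then N else N + 1, ?_, ?_⟩
    · intro m hm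
      rcases Nat.lt_succ_iff_lt_or_eq.1 hm with h | rfl
      · rw [Function.update_of_ne h.ne]
        refine (le_of_eq (sum_congr rfl fun y _ => ?_)).trans (herr m h)
        grind
      · rw [Function.update_self]
        refine (le_of_eq (sum_congr rfl fun y _ => ?_)).trans hu
        grind
    · calc _ ≤ ∑ y, ((if dec y < N then outLaw W q y else 0) + W u y / T) := by
            refine sum_le_sum fun y _ => ?_
            have h1 := outLaw_nonneg hW hq y
            have h2 : 0 ≤ W u y / T := div_nonneg (hW.nonneg u y) hT.le
            by_cases hd : dec y < N
            · simp only [hd, if_true]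
              split_ifs <;> linarith
            · by_cases hg : T * outLaw W q y ≤ W u y
              · simp only [hd, hg, if_false, if_true, Nat.lt_succ_self]
                rw [zero_add, le_div_iff₀ hT]
                linarith
              · simp only [hd, hg, if_false]
                simpa using h2
        _ ≤ _ := by
            rw [sum_add_distrib, ← sum_div, hW.sum_eq_one]
            push_cast
            rw [add_div]
            linarith

/-- Feinstein's lemma. -/
theorem feinstein {W : U → Y → ℝ} (hW : IsChannel W) {q : U → ℝ} (hq : q ∈ stdSimplex ℝ U)
    {T : ℝ} (hT : 0 < T) {M : ℕ} (hM : 0 < M) :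
    ∃ (enc : Fin M → U) (dec : Y → Fin M), ∀ m,
      ∑ y, (if dec y = m then 0 else W (enc m) y) ≤ spectrumBelow W q T + M / T := by
  obtain ⟨enc, dec, h, -⟩ := feinstein_aux hW hq hT M M le_rfl
  -- Unclaimed outputs were errors for every message, so decoding them to message `0` cannot
  -- increase any error.
  refine ⟨fun m => enc m, fun y => if h : dec y < M then ⟨dec y, h⟩ else ⟨0, hM⟩, fun m => ?_⟩
  refine (sum_le_sum fun y _ => ?_).trans (h m m.2)
  have := hW.nonneg (enc m) y
  by_cases hd : dec y = m
  · have : dec y < M := hd ▸ m.2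
    simp [hd]
  · rw [if_neg hd]
    split_ifs <;> first | assumption | exact le_rfl

/-- The Verdú–Han lower bound on the error probability of a code. -/
theorem spectrumBelow_uniform_le [DecidableEq U] {W : U → Y → ℝ} (hW : IsChannel W)
    (hq : (fun _ : U => (Fintype.card U : ℝ)⁻¹) ∈ stdSimplex ℝ U)
    {T : ℝ} (hT : 0 ≤ T) (dec : Y → U) :
    spectrumBelow W (fun _ => (Fintype.card U : ℝ)⁻¹) T ≤
      (Fintype.card U : ℝ)⁻¹ * (∑ u, ∑ y, if dec y = u then 0 else W u y) +
        T * (Fintype.card U : ℝ)⁻¹ := by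
  set k := (Fintype.card U : ℝ)⁻¹
  have hk : 0 ≤ k := by positivity
  -- A correctly decoded output with small ratio contributes at most `k * T * outLaw`. Each `y` is
  -- decoded to a single `u`, so these contributions sum to `k * T`.
  calc spectrumBelow W (fun _ => k) T
      ≤ ∑ u, ∑ y, (k * (if dec y = u then 0 else W u y) +
          if dec y = u then k * T * outLaw W (fun _ => k) y else 0) := by
        refine sum_le_sum fun u _ => sum_le_sum fun y _ => ?_
        have h1 := hW.nonneg u y
        have h2 := mul_nonneg (mul_nonneg hk hT) (outLaw_nonneg hW hq y)
        have h3 := mul_nonneg hk h1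
        split_ifs with h4 h5 h5
        · rw [mul_zero, zero_add, mul_assoc]
          exact mul_le_mul_of_nonneg_left h4.le hk
        · simp
        · simpa using h2
        · simpa using h3
    _ = _ := by
        simp_rw [sum_add_distrib, ← mul_sum]
        congr 1
        rw [sum_comm]
        simp only [sum_ite_eq, mem_univ, if_true]
        rw [← mul_sum, sum_outLaw hW hq]
        ring

/-- Since `W ≤ 1`, a ratio of at least `T` forces `outLaw ≤ 1 / T`, and such outputs have total mass
at most `card Y / T`. This is what bounds the information rates from above. -/
theorem one_sub_card_div_le_spectrumBelow {W : U → Y → ℝ} (hW : IsChannel W) {q : U → ℝ}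
    (hq : q ∈ stdSimplex ℝ U) {T : ℝ} (hT : 0 < T) :
    1 - Fintype.card Y / T ≤ spectrumBelow W q T := by
  have h : (1 : ℝ) ≤ spectrumBelow W q T + ∑ _y : Y, 1 / T := by
    calc (1 : ℝ) = ∑ u, ∑ y, q u * W u y := by
          rw [sum_comm]; exact (sum_outLaw hW hq).symm
      _ ≤ ∑ u, ∑ y, ((if W u y < T * outLaw W q y then q u * W u y else 0) +
            q u * W u y * if T * outLaw W q y ≤ 1 then 1 else 0) := by
          refine sum_le_sum fun u _ => sum_le_sum fun y _ => ?_
          have h1 : W u y ≤ 1 := by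
            rw [← hW.sum_eq_one u]
            exact single_le_sum (fun y _ => hW.nonneg u y) (mem_univ y)
          have h2 := mul_nonneg (hq.1 u) (hW.nonneg u y)
          split_ifs <;> linarith
      _ = spectrumBelow W q T +
            ∑ y, outLaw W q y * if T * outLaw W q y ≤ 1 then 1 else 0 := by
          simp_rw [sum_add_distrib]
          congr 1
          rw [sum_comm]
          simp_rw [← sum_mul]
          rfl
      _ ≤ _ := by
          gcongr with y
          split_ifs with h3
          · rw [le_div_iff₀ hT]; linarith
          · simpa using hT.le
  rw [sum_const, card_univ, nsmul_eq_mul, mul_one_div] at h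
  linarith

/-- On the support of the joint law, the information density is the logarithm
of the likelihood ratio. -/
theorem infoDensity_lt_iff {W : U → Y → ℝ} (hW : IsChannel W) {q : U → ℝ}
    (hq : q ∈ stdSimplex ℝ U) {u : U} {y : Y} (h : 0 < q u * W u y) (t : ℝ) :
    infoDensity (fun u y => q u * W u y) u y < t ↔ W u y < 2 ^ t * outLaw W q y := by
  have hqu : 0 < q u := lt_of_le_of_ne (hq.1 u) fun h0 => by simp [← h0] at h
  have hWu : 0 < W u y := lt_of_le_of_ne (hW.nonneg u y) fun h0 => by simp [← h0] at h
  have hP : 0 < outLaw W q y := h.trans_le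
    (single_le_sum (f := fun u => q u * W u y)
      (fun u _ => mul_nonneg (hq.1 u) (hW.nonneg u y)) (mem_univ u))
  unfold infoDensity
  rw [← mul_sum, hW.sum_eq_one, mul_one, mul_div_mul_left _ _ hqu.ne']
  change Real.logb 2 (W u y / outLaw W q y) < t ↔ _
  rw [Real.logb_lt_iff_lt_rpow one_lt_two (div_pos hWu hP), div_lt_iff₀ hP]

theorem sum_infoDensity_lt {W : U → Y → ℝ} (hW : IsChannel W) {q : U → ℝ}
    (hq : q ∈ stdSimplex ℝ U) (t : ℝ) :
    (∑ u, ∑ y, if infoDensity (fun u y => q u * W u y) u y < t then q u * W u y else 0) =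
      spectrumBelow W q (2 ^ t) := by
  refine sum_congr rfl fun u _ => sum_congr rfl fun y _ => ?_
  rcases (mul_nonneg (hq.1 u) (hW.nonneg u y)).eq_or_lt with h | h
  · simp [← h]
  · simp only [infoDensity_lt_iff hW hq h]

theorem uniform_mem_stdSimplex [Nonempty U] :
    (fun _ : U => (Fintype.card U : ℝ)⁻¹) ∈ stdSimplex ℝ U :=
  ⟨fun _ => by positivity, by simp⟩

end Channel

/-! ### Chebyshev's inequality on product spaces -/

section Product

theorem sum_fin_succ_fun {Y : Type*} [Fintype Y] {n : ℕ} (F : (Fin (n + 1) → Y) → ℝ) :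
    ∑ y, F y = ∑ a, ∑ y : Fin n → Y, F (Fin.cons a y) := by
  rw [← (Fin.consEquiv fun _ : Fin (n + 1) => Y).sum_comp, Fintype.sum_prod_type]
  rfl

/-- Variances of independent centred variables add: on splitting off the first coordinate, the cross
term carries the factor `∑ f h = 0`. -/
theorem sum_prod_mul_sum_sq {Y : Type*} [Fintype Y] {n : ℕ} {f h : Fin n → Y → ℝ}
    (hf : ∀ i, ∑ y, f i y = 1) (hh : ∀ i, ∑ y, f i y * h i y = 0) :
    ∑ y : Fin n → Y, (∏ i, f i (y i)) * (∑ i, h i (y i)) ^ 2 =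
      ∑ i, ∑ y, f i y * h i y ^ 2 := by
  induction n with
  | zero => simp
  | succ n ih =>
    have h1 : ∑ y : Fin n → Y, ∏ i, f (Fin.succ i) (y i) = 1 := by
      rw [← Fintype.prod_sum]
      exact Finset.prod_eq_one fun i _ => hf _
    rw [sum_fin_succ_fun, Fin.sum_univ_succ, ← ih (fun i => hf i.succ) (fun i => hh i.succ)]
    simp only [Fin.prod_univ_succ, Fin.sum_univ_succ, Fin.cons_zero, Fin.cons_succ]
    calc _ = ∑ a, ((f 0 a * h 0 a ^ 2) * (∑ y : Fin n → Y, ∏ i, f (Fin.succ i) (y i)) +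
          (f 0 a * h 0 a) * (2 * ∑ y : Fin n → Y, (∏ i, f (Fin.succ i) (y i)) *
            ∑ i, h (Fin.succ i) (y i)) +
          f 0 a * ∑ y : Fin n → Y, (∏ i, f (Fin.succ i) (y i)) *
            (∑ i, h (Fin.succ i) (y i)) ^ 2) := by
          refine sum_congr rfl fun a _ => ?_
          simp only [mul_sum, ← sum_add_distrib]
          refine sum_congr rfl fun y _ => ?_
          simp only [← mul_sum]
          ring
      _ = _ := by
          rw [sum_add_distrib, sum_add_distrib, ← sum_mul, ← sum_mul, ← sum_mul, hh, hf, h1]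
          ring

/-- Chebyshev's inequality for sums of independent random variables. -/
theorem sum_prod_ite_le {Y : Type*} [Fintype Y] {n : ℕ} {f g : Fin n → Y → ℝ}
    (hf0 : ∀ i y, 0 ≤ f i y) (hf : ∀ i, ∑ y, f i y = 1) {c V ε : ℝ} (hε : 0 < ε) (hn : 0 < n)
    (hg : ∀ i, ∑ y, f i y * g i y ≤ c) (hV : ∀ i, ∑ y, f i y * g i y ^ 2 ≤ V) :
    ∑ y : Fin n → Y, (if n * (c + ε) ≤ ∑ i, g i (y i) then ∏ i, f i (y i) else 0) ≤
      V / (n * ε ^ 2) := by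
  set m : Fin n → ℝ := fun i => ∑ y, f i y * g i y
  have hn' : (0 : ℝ) < n := by exact_mod_cast hn
  have hm : ∀ i, ∑ y, f i y * (g i y - m i) = 0 := fun i => by
    simp_rw [mul_sub]
    rw [sum_sub_distrib, ← sum_mul, hf, one_mul, sub_self]
  have hV' : ∀ i, ∑ y, f i y * (g i y - m i) ^ 2 ≤ V := fun i => by
    have : ∑ y, f i y * (g i y - m i) ^ 2 = ∑ y, f i y * g i y ^ 2 - m i ^ 2 := by
      calc _ = ∑ y, (f i y * g i y ^ 2 - 2 * m i * (f i y * g i y) + f i y * m i ^ 2) :=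
            sum_congr rfl fun y _ => by ring
        _ = ∑ y, f i y * g i y ^ 2 - 2 * m i * m i + 1 * m i ^ 2 := by
            rw [sum_add_distrib, sum_sub_distrib, ← mul_sum, ← sum_mul, hf]
        _ = _ := by ring
    have := hV i
    nlinarith [sq_nonneg (m i)]
  have key := sum_prod_mul_sum_sq (h := fun i y => g i y - m i) hf hm
  have hsq : 0 < (n * ε) ^ 2 := by positivity
  have hle : (∑ y : Fin n → Y, (if n * (c + ε) ≤ ∑ i, g i (y i) then ∏ i, f i (y i) else 0)) *
      (n * ε) ^ 2 ≤ n * V := by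
    calc _ ≤ ∑ y : Fin n → Y, (∏ i, f i (y i)) * (∑ i, (g i (y i) - m i)) ^ 2 := by
          rw [sum_mul]
          refine sum_le_sum fun y _ => ?_
          have hp : 0 ≤ ∏ i, f i (y i) := prod_nonneg fun i _ => hf0 i _
          split_ifs with h
          · refine mul_le_mul_of_nonneg_left ?_ hp
            have h2 : ∑ i, m i ≤ n * c := by
              calc ∑ i, m i ≤ ∑ _i : Fin n, c := sum_le_sum fun i _ => hg i
                _ = n * c := by simp
            have h3 : n * ε ≤ ∑ i, (g i (y i) - m i) := by
              rw [sum_sub_distrib]; linarith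
            exact pow_le_pow_left₀ (by positivity) h3 2
          · rw [zero_mul]; positivity
      _ ≤ ∑ _i : Fin n, V := by rw [key]; exact sum_le_sum fun i _ => hV' i
      _ = n * V := by simp
  rw [le_div_iff₀ (by positivity)]
  have : (n : ℝ) * ((∑ y : Fin n → Y,
      (if n * (c + ε) ≤ ∑ i, g i (y i) then ∏ i, f i (y i) else 0)) * (n * ε ^ 2)) ≤ n * V := by
    calc _ = _ := by ring
      _ ≤ _ := hle
  exact le_of_mul_le_mul_left this hn'

end Product

/-! ### Capacity-achieving inputs and the Kuhn–Tucker conditions -/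

section SingleLetter

variable {X Y : Type*} [Fintype X] [Fintype Y]

/-- Divergence (in bits) of the law `W x` from `Q`. -/
noncomputable def divergence (W : X → Y → ℝ) (x : X) (Q : Y → ℝ) : ℝ :=
  ∑ y, W x y * Real.logb 2 (W x y / Q y)

theorem outLaw_pos {W : X → Y → ℝ} (hW : IsChannel W) {p : X → ℝ} (hp : p ∈ stdSimplex ℝ X)
    {x : X} {y : Y} (h : 0 < p x * W x y) : 0 < outLaw W p y :=
  h.trans_le (single_le_sum (f := fun x => p x * W x y)
    (fun x _ => mul_nonneg (hp.1 x) (hW.nonneg x y)) (mem_univ x))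

theorem mutualInfo_eq_sum_divergence {W : X → Y → ℝ} (hW : IsChannel W) {p : X → ℝ}
    (hp : p ∈ stdSimplex ℝ X) :
    mutualInfo (fun x y => p x * W x y) = ∑ x, p x * divergence W x (outLaw W p) := by
  refine sum_congr rfl fun x _ => ?_
  rw [divergence, mul_sum]
  refine sum_congr rfl fun y _ => ?_
  rw [← mul_assoc]
  rcases (mul_nonneg (hp.1 x) (hW.nonneg x y)).eq_or_lt with h | h
  · simp [← h]
  · have hpx : p x ≠ 0 := fun h0 => by simp [h0] at h
    unfold infoDensity
    rw [← mul_sum, hW.sum_eq_one, mul_one, mul_div_mul_left _ _ hpx]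
    rfl

/-- The difference of the two sides is the divergence of the output law from `Q`, nonnegative by
`log t ≤ t - 1`. Without `hpos` the convention `log 0 = 0` would spoil the bound. -/
theorem mutualInfo_le_sum_divergence {W : X → Y → ℝ} (hW : IsChannel W) {p : X → ℝ}
    (hp : p ∈ stdSimplex ℝ X) {Q : Y → ℝ} (hQ : Q ∈ stdSimplex ℝ Y)
    (hpos : ∀ y, 0 < outLaw W p y → 0 < Q y) :
    mutualInfo (fun x y => p x * W x y) ≤ ∑ x, p x * divergence W x Q := by
  have hlog : 0 < Real.log 2 := Real.log_pos one_lt_two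
  rw [mutualInfo_eq_sum_divergence hW hp, ← sub_nonneg, ← sum_sub_distrib]
  calc (0 : ℝ) = (∑ y, (outLaw W p y - Q y)) / Real.log 2 := by
        rw [sum_sub_distrib, sum_outLaw hW hp, hQ.2, sub_self, zero_div]
    _ ≤ ∑ y, ∑ x, p x * W x y * ((1 - Q y / outLaw W p y) / Real.log 2) := by
        rw [sum_div]
        refine sum_le_sum fun y _ => ?_
        rw [← sum_mul]
        change _ ≤ outLaw W p y * _
        rw [← mul_div_assoc]
        refine div_le_div_of_nonneg_right ?_ hlog.le
        rcases (outLaw_nonneg hW hp y).eq_or_lt with h | h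
        · simpa [← h] using hQ.1 y
        · rw [mul_sub, mul_div_cancel₀ _ h.ne', mul_one]
    _ ≤ _ := by
        rw [sum_comm]
        refine sum_le_sum fun x _ => ?_
        rw [divergence, divergence, mul_sum, mul_sum, ← sum_sub_distrib]
        refine sum_le_sum fun y _ => ?_
        rw [← mul_assoc, ← mul_assoc, ← mul_sub]
        rcases (mul_nonneg (hp.1 x) (hW.nonneg x y)).eq_or_lt with h | h
        · simp [← h]
        · have ho := outLaw_pos hW hp h
          have hQy := hpos y ho
          have hWx : 0 < W x y := lt_of_le_of_ne (hW.nonneg x y) fun h0 => by simp [← h0] at h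
          refine mul_le_mul_of_nonneg_left ?_ h.le
          simp only [Real.logb]
          rw [← sub_div]
          refine div_le_div_of_nonneg_right ?_ hlog.le
          rw [Real.log_div hWx.ne' hQy.ne', Real.log_div hWx.ne' ho.ne']
          have := Real.log_le_sub_one_of_pos (div_pos hQy ho)
          rw [Real.log_div hQy.ne' ho.ne'] at this
          linarith

/-- Written with `negMulLog`, mutual information is visibly continuous up to the boundary of the
compact simplex. -/
theorem exists_isGreatest_mutualInfo [Nonempty X] {W : X → Y → ℝ} (hW : IsChannel W) :
    ∃ C, IsGreatest {I | ∃ p : stdSimplex ℝ X, I = mutualInfo (fun x y => p.1 x * W x y)} C := by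
  classical
  have hform : ∀ p ∈ stdSimplex ℝ X, mutualInfo (fun x y => p x * W x y) =
      (∑ y, Real.negMulLog (outLaw W p y) - ∑ x, p x * ∑ y, Real.negMulLog (W x y)) /
        Real.log 2 := by
    intro p hp
    have h1 : ∀ y, Real.negMulLog (outLaw W p y) =
        ∑ x, p x * W x y * (-Real.log (outLaw W p y)) := fun y => by
      rw [← sum_mul, Real.negMulLog, outLaw]; ring
    rw [mutualInfo_eq_sum_divergence hW hp, sum_congr rfl fun y _ => h1 y, sum_comm,
      ← sum_sub_distrib, sum_div]
    refine sum_congr rfl fun x _ => ?_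
    rw [divergence, mul_sum, mul_sum, ← sum_sub_distrib, sum_div]
    refine sum_congr rfl fun y _ => ?_
    rcases (mul_nonneg (hp.1 x) (hW.nonneg x y)).eq_or_lt with h | h
    · rw [← mul_assoc, ← h, Real.negMulLog]
      rw [show p x * (-W x y * Real.log (W x y)) = -(p x * W x y) * Real.log (W x y) by ring, ← h]
      simp
    · have ho := outLaw_pos hW hp h
      have hWx : 0 < W x y := lt_of_le_of_ne (hW.nonneg x y) fun h0 => by simp [← h0] at h
      rw [Real.logb, Real.log_div hWx.ne' ho.ne', Real.negMulLog]
      ring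
  have hcont : ContinuousOn (fun p : X → ℝ => mutualInfo (fun x y => p x * W x y))
      (stdSimplex ℝ X) := by
    refine ContinuousOn.congr (Continuous.continuousOn ?_) hform
    unfold outLaw
    fun_prop
  obtain ⟨p, hp, hmax⟩ := (isCompact_stdSimplex ℝ X).exists_isMaxOn
    ⟨_, single_mem_stdSimplex ℝ (Classical.arbitrary X)⟩ hcont
  refine ⟨_, ⟨⟨p, hp⟩, rfl⟩, ?_⟩
  rintro _ ⟨p', rfl⟩
  exact hmax p'.2

/-- Move the maximizer `p` by weight `t` towards the point mass at `x`, with new output law `Q`. The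
mutual information becomes `(1 - t) ∑ p D(·‖Q) + t D(W x‖Q)`, whose first sum is at least the
maximum `I(p)`. As the whole is at most `I(p)`, so is `D(W x‖Q)`. -/
theorem divergence_mix_le [DecidableEq X] {W : X → Y → ℝ} (hW : IsChannel W) {p : X → ℝ}
    (hp : p ∈ stdSimplex ℝ X)
    (hmax : ∀ p' ∈ stdSimplex ℝ X,
      mutualInfo (fun x y => p' x * W x y) ≤ mutualInfo (fun x y => p x * W x y))
    (x : X) {t : ℝ} (ht0 : 0 < t) (ht1 : t < 1) :
    divergence W x (fun y => (1 - t) * outLaw W p y + t * W x y) ≤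
      mutualInfo (fun x y => p x * W x y) := by
  set pt : X → ℝ := fun x' => (1 - t) * p x' + t * (Pi.single x 1 : X → ℝ) x'
  have hsx := single_mem_stdSimplex ℝ x
  have hpt : pt ∈ stdSimplex ℝ X :=
    convex_stdSimplex ℝ X hp hsx (by linarith) ht0.le (by ring)
  have hout : outLaw W pt = fun y => (1 - t) * outLaw W p y + t * W x y := by
    funext y
    simp only [outLaw, pt, add_mul, sum_add_distrib, mul_sum, mul_assoc]
    congr 1
    simp [Pi.single_apply]
  have hQ : outLaw W pt ∈ stdSimplex ℝ Y :=
    ⟨outLaw_nonneg hW hpt, sum_outLaw hW hpt⟩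
  have h1 := mutualInfo_le_sum_divergence hW hp hQ fun y hy => by
    rw [hout]
    have := hW.nonneg x y
    have : 0 < (1 - t) * outLaw W p y := mul_pos (by linarith) hy
    positivity
  have h2 := hmax pt hpt
  rw [mutualInfo_eq_sum_divergence hW hpt] at h2
  have h3 : ∑ x', pt x' * divergence W x' (outLaw W pt) =
      (1 - t) * (∑ x', p x' * divergence W x' (outLaw W pt)) +
        t * divergence W x (outLaw W pt) := by
    simp only [pt, add_mul, sum_add_distrib, mul_sum, mul_assoc]
    congr 1
    simp [Pi.single_apply]
  rw [h3] at h2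
  rw [← hout]
  have h4 := mul_le_mul_of_nonneg_left h1 (sub_nonneg.2 ht1.le)
  have h5 : t * divergence W x (outLaw W pt) ≤ t * mutualInfo (fun x y => p x * W x y) := by
    linarith
  exact le_of_mul_le_mul_left h5 ht0

/-- The output law of a capacity-achieving input charges every reachable letter. -/
theorem outLaw_pos_of_isMax {W : X → Y → ℝ} (hW : IsChannel W) {p : X → ℝ}
    (hp : p ∈ stdSimplex ℝ X)
    (hmax : ∀ p' ∈ stdSimplex ℝ X,
      mutualInfo (fun x y => p' x * W x y) ≤ mutualInfo (fun x y => p x * W x y))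
    {x : X} {y : Y} (hy : 0 < W x y) : 0 < outLaw W p y := by
  classical
  by_contra hc
  have h0 : outLaw W p y = 0 := le_antisymm (not_lt.1 hc) (outLaw_nonneg hW hp y)
  set C := mutualInfo (fun x y => p x * W x y)
  set B := ∑ y' ∈ univ.erase y, W x y' * Real.logb 2 (W x y')
  -- If `outLaw W p y = 0`, the ratio at `y` in the mixture of weight `t = 2 ^ (-s)` is `1 / t`,
  -- contributing `W x y * s` to the divergence. This `s` makes that contribution exceed `C - B`,
  -- where `B` bounds the other terms from below.
  set s : ℝ := (|C - B| + 1) / W x y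
  have hs : 0 < s := by positivity
  have ht0 : (0 : ℝ) < 2 ^ (-s) := by positivity
  have ht1 : (2 : ℝ) ^ (-s) < 1 := Real.rpow_lt_one_of_one_lt_of_neg one_lt_two (by linarith)
  have h := divergence_mix_le hW hp hmax x ht0 ht1
  set t : ℝ := 2 ^ (-s)
  have hle1 : ∀ {V : Y → ℝ}, V ∈ stdSimplex ℝ Y → ∀ y, V y ≤ 1 := fun {V} hV y => by
    rw [← hV.2]; exact single_le_sum (fun y _ => hV.1 y) (mem_univ y)
  have hterm : ∀ y', W x y' * Real.logb 2 (W x y') ≤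
      W x y' * Real.logb 2 (W x y' / ((1 - t) * outLaw W p y' + t * W x y')) := fun y' => by
    rcases (hW.nonneg x y').eq_or_lt with hz | hz
    · simp [← hz]
    · have ho := outLaw_nonneg hW hp y'
      have ho1 := hle1 ⟨outLaw_nonneg hW hp, sum_outLaw hW hp⟩ y'
      have hw1 := hle1 ⟨hW.nonneg x, hW.sum_eq_one x⟩ y'
      have hd : 0 < (1 - t) * outLaw W p y' + t * W x y' := by
        have := mul_nonneg (sub_nonneg.2 ht1.le) ho
        have := mul_pos ht0 hz
        linarith
      refine mul_le_mul_of_nonneg_left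
        (Real.logb_le_logb_of_le one_lt_two hz ?_) hz.le
      rw [le_div_iff₀ hd]
      have : (1 - t) * outLaw W p y' + t * W x y' ≤ 1 := by nlinarith
      nlinarith
  rw [divergence, ← add_sum_erase _ _ (mem_univ y)] at h
  have hy' : Real.logb 2 (W x y / ((1 - t) * outLaw W p y + t * W x y)) = s := by
    rw [h0, mul_zero, zero_add, div_mul_cancel_right₀ hy.ne', ← Real.rpow_neg zero_le_two,
      neg_neg, Real.logb_rpow two_pos (by norm_num)]
  rw [hy'] at h
  have hB : B ≤ ∑ y' ∈ univ.erase y,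
      W x y' * Real.logb 2 (W x y' / ((1 - t) * outLaw W p y' + t * W x y')) :=
    sum_le_sum fun y' _ => hterm y'
  have hWs : W x y * s = |C - B| + 1 := mul_div_cancel₀ _ hy.ne'
  have := le_abs_self (C - B)
  linarith

/-- The Kuhn–Tucker conditions at a capacity-achieving input. -/
theorem divergence_outLaw_le_of_isMax {W : X → Y → ℝ} (hW : IsChannel W) {p : X → ℝ}
    (hp : p ∈ stdSimplex ℝ X)
    (hmax : ∀ p' ∈ stdSimplex ℝ X,
      mutualInfo (fun x y => p' x * W x y) ≤ mutualInfo (fun x y => p x * W x y)) (x : X) :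
    divergence W x (outLaw W p) ≤ mutualInfo (fun x y => p x * W x y) := by
  classical
  -- Let the mixing weight tend to zero. Positivity of the output law on reachable letters makes
  -- each logarithm continuous there.
  have hlim : Filter.Tendsto
      (fun t : ℝ => divergence W x (fun y => (1 - t) * outLaw W p y + t * W x y))
      (nhdsWithin 0 (Set.Ioi 0)) (nhds (divergence W x (outLaw W p))) := by
    refine Filter.Tendsto.mono_left ?_ nhdsWithin_le_nhds
    refine tendsto_finsetSum _ fun y _ => ?_
    rcases (hW.nonneg x y).eq_or_lt with hz | hz
    · simp [← hz]
    · have ho := outLaw_pos_of_isMax hW hp hmax hz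
      have hc : ContinuousAt (fun t : ℝ => W x y *
          Real.logb 2 (W x y / ((1 - t) * outLaw W p y + t * W x y))) 0 := by
        have hd : (1 - (0 : ℝ)) * outLaw W p y + 0 * W x y ≠ 0 := by simpa using ho.ne'
        unfold Real.logb
        refine continuousAt_const.mul (ContinuousAt.div_const (ContinuousAt.log ?_ ?_) _)
        · exact continuousAt_const.div (by fun_prop) hd
        · exact div_ne_zero hz.ne' hd
      simpa [ContinuousAt] using hc
  refine le_of_tendsto hlim ?_
  filter_upwards [Ioo_mem_nhdsGT (zero_lt_one (α := ℝ))] with t ht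
  exact divergence_mix_le hW hp hmax x ht.1 ht.2

end SingleLetter

/-! ### Likelihood ratios of memoryless channels -/

section Memoryless

variable {X Y : Type*}

/-- `n` independent uses of the channel `W`. -/
def channelPow (W : X → Y → ℝ) (n : ℕ) (x : Fin n → X) (y : Fin n → Y) : ℝ :=
  ∏ i, W (x i) (y i)

theorem isChannel_channelPow [Fintype Y] {W : X → Y → ℝ} (hW : IsChannel W) (n : ℕ) :
    IsChannel (channelPow W n) where
  nonneg x y := prod_nonneg fun i _ => hW.nonneg _ _
  sum_eq_one x := by
    unfold channelPow
    rw [← Fintype.prod_sum fun i y => W (x i) y]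
    exact prod_eq_one fun i _ => hW.sum_eq_one _

theorem prod_mem_stdSimplex [Fintype X] {p : X → ℝ} (hp : p ∈ stdSimplex ℝ X) (n : ℕ) :
    (fun x : Fin n → X => ∏ i, p (x i)) ∈ stdSimplex ℝ (Fin n → X) := by
  refine ⟨fun x => prod_nonneg fun i _ => hp.1 _, ?_⟩
  rw [← Fintype.prod_sum fun (_ : Fin n) x => p x]
  exact prod_eq_one fun i _ => hp.2

theorem outLaw_channelPow [Fintype X] (W : X → Y → ℝ) (p : X → ℝ) {n : ℕ} (y : Fin n → Y) :
    outLaw (channelPow W n) (fun x => ∏ i, p (x i)) y = ∏ i, outLaw W p (y i) := by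
  unfold outLaw channelPow
  simp_rw [← prod_mul_distrib]
  rw [← Fintype.prod_sum fun i x => p x * W x (y i)]

/-- If all divergences from `Q` are at most `C`, then the likelihood ratio of the outputs exceeds
`2 ^ (n C)` by an exponential factor with vanishing probability only. -/
theorem exists_sum_channelPow_above_le [Fintype X] [Fintype Y] {W : X → Y → ℝ} (hW : IsChannel W) {Q : Y → ℝ} {C ε : ℝ}
    (hε : 0 < ε) (hQ : ∀ x y, 0 < W x y → 0 < Q y) (hC : ∀ x, divergence W x Q ≤ C) :
    ∃ V : ℝ, ∀ n : ℕ, 0 < n → ∀ x : Fin n → X,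
      ∑ y : Fin n → Y, (if (2 : ℝ) ^ (n * (C + ε)) * ∏ i, Q (y i) < channelPow W n x y
        then channelPow W n x y else 0) ≤ V / n := by
  set v : X → ℝ := fun x => ∑ y, W x y * Real.logb 2 (W x y / Q y) ^ 2
  have hv : ∀ x, 0 ≤ v x := fun x => sum_nonneg fun y _ =>
    mul_nonneg (hW.nonneg x y) (sq_nonneg _)
  refine ⟨(∑ x, v x) / ε ^ 2, fun n hn x => ?_⟩
  rw [div_div, mul_comm (ε ^ 2)]
  refine le_trans ?_ (sum_prod_ite_le (f := fun i y => W (x i) y)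
    (g := fun i y => Real.logb 2 (W (x i) y / Q y)) (fun i y => hW.nonneg _ _)
    (fun i => hW.sum_eq_one _) hε hn (fun i => hC (x i))
    (fun i => single_le_sum (fun x _ => hv x) (mem_univ (x i))))
  refine sum_le_sum fun y _ => ?_
  have h0 : 0 ≤ channelPow W n x y := (isChannel_channelPow hW n).nonneg x y
  change _ ≤ if _ then channelPow W n x y else 0
  rcases h0.eq_or_lt with hz | hz
  · simp [← hz]
  · have hWi : ∀ i, 0 < W (x i) (y i) := fun i =>
      lt_of_le_of_ne (hW.nonneg _ _) fun h => hz.ne' (prod_eq_zero (mem_univ i) h.symm)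
    have hQi : ∀ i, 0 < Q (y i) := fun i => hQ _ _ (hWi i)
    split_ifs with h1 h2 h2
    · exact le_rfl
    · refine absurd ?_ h2
      rw [← Real.logb_prod _ _ fun i _ => (div_pos (hWi i) (hQi i)).ne', prod_div_distrib,
        Real.le_logb_iff_rpow_le one_lt_two (div_pos (prod_pos fun i _ => hWi i) (prod_pos fun i _ => hQi i)),
        le_div_iff₀ (prod_pos fun i _ => hQi i)]
      exact h1.le
    · exact h0
    · exact le_rfl

/-- For an i.i.d. input the information density is a sum of i.i.d. terms with mean the mutual
information. The sign is flipped in `g` because the available Chebyshev bound concerns the upper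
tail. -/
theorem exists_spectrumBelow_channelPow_le [Fintype X] [Fintype Y] {W : X → Y → ℝ} (hW : IsChannel W) {p : X → ℝ}
    (hp : p ∈ stdSimplex ℝ X) {ε : ℝ} (hε : 0 < ε) :
    ∃ V : ℝ, ∀ n : ℕ, 0 < n →
      spectrumBelow (channelPow W n) (fun x => ∏ i, p (x i))
        (2 ^ (n * (mutualInfo (fun x y => p x * W x y) - ε))) ≤ V / n := by
  set C := mutualInfo (fun x y => p x * W x y)
  set g : X × Y → ℝ := fun z => -Real.logb 2 (W z.1 z.2 / outLaw W p z.2)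
  refine ⟨(∑ z : X × Y, p z.1 * W z.1 z.2 * g z ^ 2) / ε ^ 2, fun n hn => ?_⟩
  rw [div_div, mul_comm (ε ^ 2)]
  refine le_trans ?_ (sum_prod_ite_le (n := n) (f := fun _ (z : X × Y) => p z.1 * W z.1 z.2)
    (g := fun _ => g) (c := -C) (fun i z => mul_nonneg (hp.1 _) (hW.nonneg _ _)) (fun i => ?_) hε hn
    (fun i => ?_) (fun i => le_rfl))
  · rw [← (Equiv.arrowProdEquivProdArrow (Fin n) (fun _ => X) (fun _ => Y)).symm.sum_comp,
      Fintype.sum_prod_type]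
    refine sum_le_sum fun x _ => sum_le_sum fun y _ => ?_
    have hXY : (∏ i, p (x i)) * channelPow W n x y = ∏ i, p (x i) * W (x i) (y i) :=
      prod_mul_distrib.symm
    have h0 : 0 ≤ ∏ i, p (x i) * W (x i) (y i) :=
      prod_nonneg fun i _ => mul_nonneg (hp.1 _) (hW.nonneg _ _)
    rw [hXY, outLaw_channelPow]
    change _ ≤ if _ then ∏ i, p (x i) * W (x i) (y i) else 0
    rcases h0.eq_or_lt with hz | hz
    · simp [← hz]
    · have hi : ∀ i, 0 < p (x i) * W (x i) (y i) := fun i =>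
        lt_of_le_of_ne (mul_nonneg (hp.1 _) (hW.nonneg _ _))
          fun h => hz.ne' (prod_eq_zero (mem_univ i) h.symm)
      have hWi : ∀ i, 0 < W (x i) (y i) := fun i =>
        lt_of_le_of_ne (hW.nonneg _ _) fun h => by simpa [← h] using hi i
      have hoi : ∀ i, 0 < outLaw W p (y i) := fun i => outLaw_pos hW hp (hi i)
      split_ifs with h1 h2 h2
      · exact le_rfl
      · refine absurd ?_ h2
        have h3 : ∑ i, Real.logb 2 (W (x i) (y i) / outLaw W p (y i)) < n * (C - ε) := by
          rw [← Real.logb_prod _ _ fun i _ => (div_pos (hWi i) (hoi i)).ne', prod_div_distrib,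
            Real.logb_lt_iff_lt_rpow one_lt_two
              (div_pos (prod_pos fun i _ => hWi i) (prod_pos fun i _ => hoi i)),
            div_lt_iff₀ (prod_pos fun i _ => hoi i)]
          exact h1
        change _ ≤ ∑ i, -Real.logb 2 (W (x i) (y i) / outLaw W p (y i))
        rw [sum_neg_distrib]
        linarith
      · exact h0
      · exact le_rfl
  · rw [Fintype.sum_prod_type]
    simp_rw [← mul_sum, hW.sum_eq_one, mul_one]
    exact hp.2
  · refine le_of_eq ?_
    rw [show C = _ from mutualInfo_eq_sum_divergence hW hp, Fintype.sum_prod_type,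
      ← sum_neg_distrib]
    refine sum_congr rfl fun x _ => ?_
    rw [divergence, mul_sum, ← sum_neg_distrib]
    refine sum_congr rfl fun y _ => ?_
    simp only [g]
    ring

end Memoryless

/-! ### Dropping the output of the side channel -/

section SideChannel

variable {U I Y₁ Y₂ : Type*} [Fintype U] [Fintype I] [Fintype Y₁] [Fintype Y₂]

/-- If given `U` and the state the outputs `Y₁` and `Y₂` are independent, and the likelihood ratio of
`Y₁` to a fixed law `Q` is at most `S` except with probability `η`, then dropping `Y₁` loses
at most a factor `S / δ ^ 2` in the likelihood ratio, except with probability `2 * δ + η`. -/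
theorem spectrumBelow_marginal_le {p : I → ℝ} (hp : p ∈ stdSimplex ℝ I)
    {a : U → I → Y₁ → ℝ} {b : U → I → Y₂ → ℝ} (ha : ∀ u, IsChannel (a u))
    (hb : ∀ u, IsChannel (b u)) {W : U → Y₁ × Y₂ → ℝ} {W₂ : U → Y₂ → ℝ}
    (hW : ∀ u y, W u y = ∑ i, p i * (a u i y.1 * b u i y.2))
    (hW₂ : ∀ u y, W₂ u y = ∑ i, p i * b u i y)
    {q : U → ℝ} (hq : q ∈ stdSimplex ℝ U) {Q : Y₁ → ℝ} (hQ : Q ∈ stdSimplex ℝ Y₁)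
    {T δ S η : ℝ} (hT : 0 < T) (hδ : 0 < δ) (hS : 0 < S)
    (hη : ∀ u i, ∑ y, (if S * Q y < a u i y then a u i y else 0) ≤ η) :
    spectrumBelow W₂ q (δ ^ 2 * T / S) ≤ spectrumBelow W q T + 2 * δ + η := by
  classical
  have hsumab : ∀ u i, ∑ y : Y₁ × Y₂, a u i y.1 * b u i y.2 = 1 := fun u i => by
    rw [Fintype.sum_prod_type]
    simp_rw [← mul_sum, (hb u).sum_eq_one, mul_one, (ha u).sum_eq_one]
  have hWc : IsChannel W := by
    refine ⟨fun u y => ?_, fun u => ?_⟩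
    · rw [hW]
      exact sum_nonneg fun i _ => mul_nonneg (hp.1 i)
        (mul_nonneg ((ha u).nonneg _ _) ((hb u).nonneg _ _))
    · simp_rw [hW]
      rw [sum_comm]
      simp_rw [← mul_sum, hsumab, mul_one]
      exact hp.2
  have hW₂c : IsChannel W₂ := by
    refine ⟨fun u y => ?_, fun u => ?_⟩
    · rw [hW₂]
      exact sum_nonneg fun i _ => mul_nonneg (hp.1 i) ((hb u).nonneg _ _)
    · simp_rw [hW₂]
      rw [sum_comm]
      simp_rw [← mul_sum, (hb u).sum_eq_one, mul_one]
      exact hp.2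
  have hmarg : ∀ u y₂, ∑ y₁, W u (y₁, y₂) = W₂ u y₂ := fun u y₂ => by
    simp_rw [hW, hW₂]
    rw [sum_comm]
    simp_rw [← mul_sum, ← sum_mul, (ha u).sum_eq_one, one_mul]
  -- The state stays in the joint law, because the two outputs are independent only given it.
  set μ : U → I → Y₁ × Y₂ → ℝ := fun u i y => q u * (p i * (a u i y.1 * b u i y.2))
  have hμ0 : ∀ u i y, 0 ≤ μ u i y := fun u i y => mul_nonneg (hq.1 u) (mul_nonneg (hp.1 i)
    (mul_nonneg ((ha u).nonneg _ _) ((hb u).nonneg _ _)))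
  have hfold : ∀ c : U → Y₁ × Y₂ → Prop, ∑ u, ∑ i, ∑ y, (if c u y then μ u i y else 0) =
      ∑ u, ∑ y, if c u y then q u * W u y else 0 := fun c => by
    refine sum_congr rfl fun u _ => ?_
    rw [sum_comm]
    refine sum_congr rfl fun y _ => ?_
    split_ifs
    · rw [hW, mul_sum]
    · simp
  have hlhs : spectrumBelow W₂ q (δ ^ 2 * T / S) = ∑ u, ∑ i, ∑ y : Y₁ × Y₂,
      (if W₂ u y.2 < δ ^ 2 * T / S * outLaw W₂ q y.2 then μ u i y else 0) := by
    rw [hfold fun u y => W₂ u y.2 < δ ^ 2 * T / S * outLaw W₂ q y.2]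
    refine sum_congr rfl fun u _ => ?_
    rw [Fintype.sum_prod_type_right]
    refine sum_congr rfl fun y₂ _ => ?_
    dsimp only
    split_ifs
    · rw [← mul_sum, hmarg]
    · simp
  have h1 : ∑ u, ∑ i, ∑ y, (if W u y < T * outLaw W q y then μ u i y else 0) =
      spectrumBelow W q T := hfold _
  -- Change of measure: `Q × outLaw W₂ q` has total mass one, so the outputs whose true mass is
  -- below `δ` times it have probability at most `δ`.
  have h2 : ∑ u, ∑ i, ∑ y, (if outLaw W q y < δ * (Q y.1 * outLaw W₂ q y.2) then μ u i y else 0)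
      ≤ δ := by
    rw [hfold fun u y => outLaw W q y < δ * (Q y.1 * outLaw W₂ q y.2), sum_comm]
    calc _ ≤ ∑ y : Y₁ × Y₂, δ * (Q y.1 * outLaw W₂ q y.2) := by
          refine sum_le_sum fun y _ => ?_
          split_ifs with h
          · exact h.le
          · simpa using mul_nonneg hδ.le (mul_nonneg (hQ.1 _) (outLaw_nonneg hW₂c hq _))
      _ = δ := by
          rw [← mul_sum, Fintype.sum_prod_type]
          simp_rw [← mul_sum, sum_outLaw hW₂c hq, mul_one, hQ.2, mul_one]
  -- Markov's inequality for `W / (a * W₂)`: summing `p i * b u i` over the state rebuilds `W₂`,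
  -- which cancels the denominator, so the mean is at most one.
  have h3 : ∑ u, ∑ i, ∑ y : Y₁ × Y₂, (if a u i y.1 * W₂ u y.2 < δ * W u y then μ u i y else 0)
      ≤ δ := by
    calc _ ≤ ∑ u, ∑ i, ∑ y : Y₁ × Y₂, q u * (δ * W u y / W₂ u y.2) * (p i * b u i y.2) := by
          refine sum_le_sum fun u _ => sum_le_sum fun i _ => sum_le_sum fun y _ => ?_
          have hb0 := mul_nonneg (hp.1 i) ((hb u).nonneg i y.2)
          have hr : 0 ≤ q u * (δ * W u y / W₂ u y.2) * (p i * b u i y.2) :=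
            mul_nonneg (mul_nonneg (hq.1 u)
              (div_nonneg (mul_nonneg hδ.le (hWc.nonneg _ _)) (hW₂c.nonneg _ _))) hb0
          split_ifs with h
          · have hle : p i * b u i y.2 ≤ W₂ u y.2 := by
              rw [hW₂]
              exact single_le_sum (f := fun i => p i * b u i y.2)
                (fun i _ => mul_nonneg (hp.1 i) ((hb u).nonneg i y.2)) (mem_univ i)
            rcases hb0.eq_or_lt with hz | hz
            · have : μ u i y = q u * a u i y.1 * (p i * b u i y.2) := by simp only [μ]; ring
              rw [this, ← hz]
              simp
            · have hW2 : 0 < W₂ u y.2 := hz.trans_le hle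
              calc μ u i y = q u * a u i y.1 * (p i * b u i y.2) := by simp only [μ]; ring
                _ ≤ _ := by
                  refine mul_le_mul_of_nonneg_right
                    (mul_le_mul_of_nonneg_left ?_ (hq.1 u)) hb0
                  rw [le_div_iff₀ hW2]
                  exact h.le
          · exact hr
      _ ≤ ∑ u, ∑ y, q u * (δ * W u y) := by
          refine sum_le_sum fun u _ => ?_
          rw [sum_comm]
          refine sum_le_sum fun y _ => ?_
          rw [← mul_sum, ← hW₂, mul_assoc]
          refine mul_le_mul_of_nonneg_left ?_ (hq.1 u)
          rcases (hW₂c.nonneg u y.2).eq_or_lt with hz | hz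
          · rw [← hz, mul_zero]
            exact mul_nonneg hδ.le (hWc.nonneg _ _)
          · rw [div_mul_cancel₀ _ hz.ne']
      _ = δ := by
          simp_rw [← mul_sum, hWc.sum_eq_one, mul_one, ← sum_mul, hq.2, one_mul]
  have h4 : ∑ u, ∑ i, ∑ y : Y₁ × Y₂, (if S * Q y.1 < a u i y.1 then μ u i y else 0) ≤ η := by
    calc _ = ∑ u, q u * ∑ i, p i * ∑ y, (if S * Q y < a u i y then a u i y else 0) := by
          refine sum_congr rfl fun u _ => ?_
          rw [mul_sum]
          refine sum_congr rfl fun i _ => ?_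
          rw [Fintype.sum_prod_type, mul_sum, mul_sum]
          refine sum_congr rfl fun y _ => ?_
          dsimp only
          split_ifs
          · simp only [μ, ← mul_sum, (hb u).sum_eq_one, mul_one]
          · simp
      _ ≤ ∑ u, q u * ∑ i, p i * η := sum_le_sum fun u _ =>
          mul_le_mul_of_nonneg_left (sum_le_sum fun i _ =>
            mul_le_mul_of_nonneg_left (hη u i) (hp.1 i)) (hq.1 u)
      _ = η := by simp_rw [← sum_mul, hp.2, one_mul, hq.2, one_mul]
  rw [hlhs, ← h1]
  calc _ ≤ ∑ u, ∑ i, ∑ y : Y₁ × Y₂, ((if W u y < T * outLaw W q y then μ u i y else 0) +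
        (if outLaw W q y < δ * (Q y.1 * outLaw W₂ q y.2) then μ u i y else 0) +
        (if a u i y.1 * W₂ u y.2 < δ * W u y then μ u i y else 0) +
        (if S * Q y.1 < a u i y.1 then μ u i y else 0)) := by
        refine sum_le_sum fun u _ => sum_le_sum fun i _ => sum_le_sum fun y _ => ?_
        have hm := hμ0 u i y
        have hnn : ∀ c : Prop, 0 ≤ if c then μ u i y else 0 := fun c => by
          split_ifs <;> simp [hm]
        -- Outside the four events, `a ≤ S Q`, `δ W ≤ a W₂`, `T P ≤ W` and `δ Q P₂ ≤ P` (with `P`,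
        -- `P₂` the output laws) chain to `δ ^ 2 * T / S * P₂ ≤ W₂` wherever `μ` is positive.
        by_cases hc : W u y < T * outLaw W q y ∨ outLaw W q y < δ * (Q y.1 * outLaw W₂ q y.2) ∨
            a u i y.1 * W₂ u y.2 < δ * W u y ∨ S * Q y.1 < a u i y.1
        · have hle : (if W₂ u y.2 < δ ^ 2 * T / S * outLaw W₂ q y.2 then μ u i y else 0) ≤
              μ u i y := by split_ifs <;> simp [hm]
          have n1 := hnn (W u y < T * outLaw W q y)
          have n2 := hnn (outLaw W q y < δ * (Q y.1 * outLaw W₂ q y.2))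
          have n3 := hnn (a u i y.1 * W₂ u y.2 < δ * W u y)
          have n4 := hnn (S * Q y.1 < a u i y.1)
          rcases hc with h | h | h | h
          · rw [if_pos h] at n1 ⊢; linarith
          · rw [if_pos h] at n2 ⊢; linarith
          · rw [if_pos h] at n3 ⊢; linarith
          · rw [if_pos h] at n4 ⊢; linarith
        · push Not at hc
          obtain ⟨c1, c2, c3, c4⟩ := hc
          have hz : (if W₂ u y.2 < δ ^ 2 * T / S * outLaw W₂ q y.2 then μ u i y else 0) = 0 := by
            rcases hm.eq_or_lt with hz | hz
            · simp [← hz]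
            · rw [if_neg]
              intro hlt
              have hapos : 0 < a u i y.1 := lt_of_le_of_ne ((ha u).nonneg _ _) fun h0 => by
                simp [μ, ← h0] at hz
              have hP2 := outLaw_nonneg hW₂c hq y.2
              have e1 : a u i y.1 * W₂ u y.2 <
                  a u i y.1 * (δ ^ 2 * T / S * outLaw W₂ q y.2) :=
                mul_lt_mul_of_pos_left hlt hapos
              have e2 : a u i y.1 * (δ ^ 2 * T / S * outLaw W₂ q y.2) ≤
                  S * Q y.1 * (δ ^ 2 * T / S * outLaw W₂ q y.2) :=
                mul_le_mul_of_nonneg_right c4 (by positivity)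
              have e3 : S * Q y.1 * (δ ^ 2 * T / S * outLaw W₂ q y.2) =
                  δ * (T * (δ * (Q y.1 * outLaw W₂ q y.2))) := by
                field_simp
              have e4 : δ * (T * (δ * (Q y.1 * outLaw W₂ q y.2))) ≤ δ * W u y :=
                mul_le_mul_of_nonneg_left
                  ((mul_le_mul_of_nonneg_left c2 hT.le).trans c1) hδ.le
              linarith
          rw [hz]
          have n1 := hnn (W u y < T * outLaw W q y)
          have n2 := hnn (outLaw W q y < δ * (Q y.1 * outLaw W₂ q y.2))
          have n3 := hnn (a u i y.1 * W₂ u y.2 < δ * W u y)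
          have n4 := hnn (S * Q y.1 < a u i y.1)
          linarith
    _ ≤ _ := by
        simp only [sum_add_distrib]
        linarith

theorem spectrumBelow_comp_equiv {Y Y' : Type*} [Fintype Y] [Fintype Y'] (e : Y' ≃ Y)
    (W : U → Y → ℝ) (q : U → ℝ) (T : ℝ) :
    spectrumBelow (fun u y => W u (e y)) q T = spectrumBelow W q T := by
  refine sum_congr rfl fun u _ => ?_
  rw [← e.sum_comp]
  rfl

end SideChannel

/-! ### Message counts and asymptotic direct coding -/

section Rates

theorem tendsto_two_rpow_neg {ε : ℝ} (hε : 0 < ε) :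
    Tendsto (fun n : ℕ => (2 : ℝ) ^ (-((n : ℝ) * ε))) atTop (nhds 0) := by
  have h : ∀ n : ℕ, (2 : ℝ) ^ (-((n : ℝ) * ε)) = ((2 : ℝ) ^ (-ε)) ^ n := fun n => by
    rw [← Real.rpow_natCast, ← Real.rpow_mul zero_le_two]
    congr 1
    ring
  simp_rw [h]
  exact tendsto_pow_atTop_nhds_zero_of_lt_one (by positivity)
    (Real.rpow_lt_one_of_one_lt_of_neg one_lt_two (by linarith))

theorem numMessages_pos (n : ℕ) (R : ℝ) : 0 < numMessages n R :=
  Nat.ceil_pos.2 (by positivity)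

theorem numMessages_zero (n : ℕ) : numMessages n 0 = 1 := by simp [numMessages]

theorem two_rpow_le_numMessages (n : ℕ) (R : ℝ) : (2 : ℝ) ^ ((n : ℝ) * R) ≤ numMessages n R :=
  Nat.le_ceil _

theorem numMessages_le (n : ℕ) {R : ℝ} (hR : 0 ≤ R) :
    (numMessages n R : ℝ) ≤ 2 * 2 ^ ((n : ℝ) * R) := by
  have h1 : (1 : ℝ) ≤ 2 ^ ((n : ℝ) * R) := Real.one_le_rpow one_le_two (by positivity)
  have h2 := (Nat.ceil_lt_add_one (zero_le_one.trans h1)).le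
  unfold numMessages
  linarith

/-- The rounding is favourable twice: pairs of messages can carry a message of the sum rate, and a
pair code is large enough for the converse at the sum rate. -/
theorem numMessages_add_le (n : ℕ) (R₁ R₂ : ℝ) :
    numMessages n (R₁ + R₂) ≤ numMessages n R₁ * numMessages n R₂ := by
  refine Nat.ceil_le.2 ?_
  rw [mul_add, Real.rpow_add two_pos]
  push_cast
  exact mul_le_mul (two_rpow_le_numMessages n R₁) (two_rpow_le_numMessages n R₂) (by positivity)
    (by positivity)

/-- Direct coding theorem for a sequence of channels: rates below the spectral
inf-information rate are achieved with vanishing maximal error probability. -/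
theorem exists_codes_of_spectrumBelow {U Y : ℕ → Type*} [∀ n, Fintype (U n)] [∀ n, Fintype (Y n)]
    {W : ∀ n, U n → Y n → ℝ} (hW : ∀ n, IsChannel (W n)) {q : ∀ n, U n → ℝ}
    (hq : ∀ n, q n ∈ stdSimplex ℝ (U n)) {R r : ℝ} (hR : 0 ≤ R) (hRr : R < r)
    (h : ∀ ε : ℝ, 0 < ε → Tendsto
      (fun n : ℕ => spectrumBelow (W n) (q n) (2 ^ ((n : ℝ) * (r - ε)))) atTop (nhds 0)) :
    ∃ (enc : ∀ n, Fin (numMessages n R) → U n) (dec : ∀ n, Y n → Fin (numMessages n R))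
      (e : ℕ → ℝ), Tendsto e atTop (nhds 0) ∧
      ∀ n m, ∑ y, (if dec n y = m then 0 else W n (enc n m) y) ≤ e n := by
  -- Half the gap keeps the threshold `2 ^ (n (r - ε))` a factor `2 ^ (n ε)` above `2 ^ (n R)`, so
  -- the term `M / T` vanishes.
  set ε := (r - R) / 2
  have hε : 0 < ε := by simp only [ε]; linarith
  have hF := fun n => feinstein (hW n) (hq n)
    (T := (2 : ℝ) ^ ((n : ℝ) * (r - ε))) (by positivity) (numMessages_pos n R)
  choose enc dec hed using hF
  refine ⟨enc, dec, fun n => spectrumBelow (W n) (q n) (2 ^ ((n : ℝ) * (r - ε))) +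
    2 * 2 ^ (-((n : ℝ) * ε)), ?_, fun n m => (hed n m).trans ?_⟩
  · simpa using (h ε hε).add ((tendsto_two_rpow_neg hε).const_mul 2)
  · refine add_le_add le_rfl ?_
    rw [div_le_iff₀ (by positivity), mul_assoc, ← Real.rpow_add two_pos]
    have hexp : -((n : ℝ) * ε) + n * (r - ε) = n * R := by
      simp only [ε]
      ring
    rw [hexp]
    exact numMessages_le n hR

end Rates

/-! ### Laws of the relay channel and the converse -/

theorem sum_prod_causal {Y : Type*} [Fintype Y] {n : ℕ} {K : (i : Fin n) → (Fin i → Y) → Y → ℝ}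
    (hK : ∀ i h, ∑ y, K i h y = 1) : ∑ y : Fin n → Y, ∏ i, K i (past y i) (y i) = 1 := by
  induction n with
  | zero => simp
  | succ n ih =>
    -- The last letter occurs in no past, so its kernel can be summed out first.
    rw [← (Fin.snocEquiv fun _ : Fin (n + 1) => Y).sum_comp, Fintype.sum_prod_type, sum_comm,
      ← ih (K := fun i h y => K i.castSucc h y) fun i h => hK _ _]
    refine sum_congr rfl fun y _ => ?_
    simp only [Fin.prod_univ_castSucc, Fin.snocEquiv_apply]
    have h1 : ∀ (a : Y) (i : Fin n), past (Fin.snocEquiv (fun _ : Fin (n + 1) => Y) (a, y)) i.castSucc =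
        past y i := fun a i => by
        funext j
        exact Fin.snoc_castSucc (α := fun _ => Y) a y (Fin.castLE i.isLt.le j)
    have h2 : ∀ a : Y, past (Fin.snocEquiv (fun _ : Fin (n + 1) => Y) (a, y)) (Fin.last n) = y :=
      fun a => by
      funext j
      exact Fin.snoc_castSucc (α := fun _ => Y) a y j
    simp only [h1, h2, Fin.snoc_castSucc, Fin.snoc_last]
    rw [← mul_sum, hK, mul_one]

namespace RelayChannel

variable {XSD XSR XR XI YR YD YD₁ YD₂ M : Type*}
variable [Fintype YR] [Fintype YD] [Fintype YD₁] [Fintype YD₂]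

theorem destProb_nonneg (P : RelayChannel XSD XSR XR XI YR YD) {n : ℕ}
    (xSD : Fin n → XSD) (xSR : Fin n → XSR) (relay : (i : Fin n) → (Fin i → YR) → XR)
    (xI : Fin n → XI) (yD : Fin n → YD) : 0 ≤ P.destProb xSD xSR relay xI yD :=
  sum_nonneg fun _ _ => prod_nonneg fun _ _ =>
    mul_nonneg ((P.toRelay _ _).2.1 _) ((P.toDest _ _ _).2.1 _)

theorem sum_destProb (P : RelayChannel XSD XSR XR XI YR YD) {n : ℕ}
    (xSD : Fin n → XSD) (xSR : Fin n → XSR) (relay : (i : Fin n) → (Fin i → YR) → XR)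
    (xI : Fin n → XI) : ∑ yD, P.destProb xSD xSR relay xI yD = 1 := by
  unfold destProb
  rw [sum_comm, ← sum_prod_causal (K := fun i h y => (P.toRelay (xSR i) (relay i h)).1 y)
    fun i h => (P.toRelay _ _).2.2]
  refine sum_congr rfl fun yR _ => ?_
  simp_rw [prod_mul_distrib]
  rw [← mul_sum,
    ← Fintype.prod_sum fun i y => (P.toDest (xSD i) (relay i (past yR i)) (xI i)).1 y,
    prod_eq_one fun i _ => (P.toDest _ _ _).2.2, mul_one]

theorem isChannel_outputLaw (P : RelayChannel XSD XSR XR XI YR YD) (J : InterfererCodebook XI)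
    {n : ℕ} (s : Strategy XSD XSR XR YR M (J.size n) n) : IsChannel (P.outputLaw J s) where
  nonneg m y := mul_nonneg (by positivity) (sum_nonneg fun _ _ => P.destProb_nonneg _ _ _ _ _)
  sum_eq_one m := by
    unfold outputLaw
    rw [← mul_sum, sum_comm]
    simp_rw [sum_destProb]
    have := J.size_pos n
    simp [this.ne']

/-- The S-D factor does not involve the relay outputs and leaves the sum over them. This holds for a
fixed interferer codeword; averaging over `W_I` preserves the product form when the S-D signal
ignores `W_I`. -/
theorem destProb_eq_mul {P : RelayChannel XSD XSR XR XI YR (YD₁ × YD₂)}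
    {P₁ : XSD → stdSimplex ℝ YD₁} {P₂ : XR → XI → stdSimplex ℝ YD₂}
    (hP : ∀ xSD xR xI y₁ y₂,
      (P.toDest xSD xR xI).1 (y₁, y₂) = (P₁ xSD).1 y₁ * (P₂ xR xI).1 y₂) {n : ℕ}
    (xSD : Fin n → XSD) (xSR : Fin n → XSR) (relay : (i : Fin n) → (Fin i → YR) → XR)
    (xI : Fin n → XI) (yD : Fin n → YD₁ × YD₂) :
    P.destProb xSD xSR relay xI yD =
      channelPow (fun x y => (P₁ x).1 y) n xSD (fun i => (yD i).1) *
        (multihop P.toRelay P₂).destProb (fun _ => ()) xSR relay xI (fun i => (yD i).2) := by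
  unfold destProb channelPow
  rw [mul_sum]
  refine sum_congr rfl fun yR _ => ?_
  rw [← prod_mul_distrib]
  refine prod_congr rfl fun i _ => ?_
  change _ * (P.toDest _ _ _).1 ((yD i).1, (yD i).2) = _
  rw [hP]
  change _ = (P₁ (xSD i)).1 (yD i).1 * ((P.toRelay (xSR i) (relay i (past yR i))).1 (yR i) *
    (P₂ (relay i (past yR i)) (xI i)).1 (yD i).2)
  ring

theorem isInformationRate_iff (P : RelayChannel XSD XSR XR XI YR YD) (J : InterfererCodebook XI)
    (r : ℝ) : P.IsInformationRate J r ↔ ∃ (k : ℕ → ℕ) (q : ∀ n, stdSimplex ℝ (Fin (k n)))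
      (s : ∀ n, Strategy XSD XSR XR YR (Fin (k n)) (J.size n) n),
      ∀ ε : ℝ, 0 < ε → Tendsto (fun n : ℕ => spectrumBelow (P.outputLaw J (s n)) (q n).1
        (2 ^ ((n : ℝ) * (r - ε)))) atTop (nhds 0) := by
  unfold IsInformationRate
  refine exists_congr fun k => exists_congr fun q => exists_congr fun s =>
    forall₂_congr fun ε _ => ?_
  refine iff_of_eq (congrArg (Tendsto · atTop (nhds 0)) (funext fun n => ?_))
  rw [← sum_infoDensity_lt (P.isChannel_outputLaw J (s n)) (q n).2]
  refine sum_congr rfl fun u _ => sum_congr rfl fun y _ => ?_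
  simp only [show P.jointLaw J (q n) (s n) = fun u y => (q n).1 u * P.outputLaw J (s n) u y from rfl]

theorem spectrumBelow_le_errorProb (P : RelayChannel XSD XSR XR XI YR YD)
    (J : InterfererCodebook XI) [Fintype M] [DecidableEq M] [Nonempty M] {n : ℕ}
    (c : Code XSD XSR XR YR YD M (J.size n) n) {R ε : ℝ}
    (hM : (2 : ℝ) ^ ((n : ℝ) * R) ≤ Fintype.card M) :
    spectrumBelow (P.outputLaw J c.toStrategy) (fun _ => (Fintype.card M : ℝ)⁻¹)
      (2 ^ ((n : ℝ) * (R - ε))) ≤ P.errorProb J c + 2 ^ (-((n : ℝ) * ε)) := by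
  refine (spectrumBelow_uniform_le (P.isChannel_outputLaw J c.toStrategy) uniform_mem_stdSimplex
    (by positivity) c.dec).trans (add_le_add le_rfl ?_)
  rw [← div_eq_mul_inv, div_le_iff₀ (by positivity), mul_sub, Real.rpow_sub two_pos,
    Real.rpow_neg zero_le_two, div_eq_inv_mul]
  gcongr

/-- A code with vanishing error probability turns its rate into an information rate. -/
theorem isInformationRate_of_achievable {P : RelayChannel XSD XSR XR XI YR YD}
    {J : InterfererCodebook XI} {R : ℝ} (h : P.Achievable J R) : P.IsInformationRate J R := by
  obtain ⟨-, c, hc⟩ := h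
  have hne : ∀ n, Nonempty (Fin (numMessages n R)) := fun n => ⟨⟨0, numMessages_pos n R⟩⟩
  refine (isInformationRate_iff _ _ _).2 ⟨fun n => numMessages n R,
    fun n => ⟨_, uniform_mem_stdSimplex⟩, fun n => (c n).toStrategy, fun ε hε => ?_⟩
  refine squeeze_zero (fun n => spectrumBelow_nonneg (P.isChannel_outputLaw J _)
    uniform_mem_stdSimplex _) (fun n => P.spectrumBelow_le_errorProb J (c n) ?_)
    (by simpa using hc.add (tendsto_two_rpow_neg hε))
  rw [Fintype.card_fin]
  exact two_rpow_le_numMessages n R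

/-- Codes with vanishing error probability and rate `R` leave the information rate `R - C` to the
S-R-D link, where `C` bounds the divergences of the S-D link from a fixed output law. -/
theorem isInformationRate_multihop_sub {P : RelayChannel XSD XSR XR XI YR (YD₁ × YD₂)}
    {P₁ : XSD → stdSimplex ℝ YD₁} {P₂ : XR → XI → stdSimplex ℝ YD₂} [Fintype XSD]
    (hP : ∀ xSD xR xI y₁ y₂,
      (P.toDest xSD xR xI).1 (y₁, y₂) = (P₁ xSD).1 y₁ * (P₂ xR xI).1 y₂)
    {J : InterfererCodebook XI} {Q : YD₁ → ℝ} (hQ : Q ∈ stdSimplex ℝ YD₁)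
    (hpos : ∀ x y, 0 < (P₁ x).1 y → 0 < Q y) {C : ℝ}
    (hC : ∀ x, divergence (fun x y => (P₁ x).1 y) x Q ≤ C)
    {R : ℝ} {k : ℕ → ℕ} (hk : ∀ n : ℕ, (2 : ℝ) ^ ((n : ℝ) * R) ≤ k n)
    {c : ∀ n, Code XSD XSR XR YR (YD₁ × YD₂) (Fin (k n)) (J.size n) n}
    (hc : Tendsto (fun n => P.errorProb J (c n)) atTop (nhds 0)) :
    (multihop P.toRelay P₂).IsInformationRate J (R - C) := by
  have hne : ∀ n, Nonempty (Fin (k n)) := fun n => ⟨⟨0, by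
    have : (0 : ℝ) < k n := lt_of_lt_of_le (by positivity) (hk n)
    exact_mod_cast this⟩⟩
  have hW₁ : IsChannel fun x y => (P₁ x).1 y := ⟨fun x => (P₁ x).2.1, fun x => (P₁ x).2.2⟩
  -- The whole message serves as `U_n`; only the S-R encoder and the relay of the code are kept.
  set s : ∀ n, Strategy Unit XSR XR YR (Fin (k n)) (J.size n) n := fun n =>
    { encSD := fun _ _ _ => (), encSR := (c n).encSR, relay := (c n).relay }
  refine (isInformationRate_iff _ _ _).2 ⟨k, fun n => ⟨_, uniform_mem_stdSimplex⟩, s,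
    fun ε hε => ?_⟩
  -- Verdú–Han costs one `ε'`, the factor `δ ^ 2` two, and the bound `S` one.
  set ε' := ε / 4
  have hε' : 0 < ε' := by simp only [ε']; linarith
  obtain ⟨V, hV⟩ := exists_sum_channelPow_above_le hW₁ hε' hpos hC
  have hbound : ∀ᶠ n : ℕ in atTop,
      spectrumBelow ((multihop P.toRelay P₂).outputLaw J (s n))
        (fun _ => (Fintype.card (Fin (k n)) : ℝ)⁻¹) (2 ^ ((n : ℝ) * (R - C - ε))) ≤
      P.errorProb J (c n) + 2 ^ (-((n : ℝ) * ε')) + 2 * 2 ^ (-((n : ℝ) * ε')) + V / n := by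
    filter_upwards [eventually_gt_atTop 0] with n hn
    have hsz := J.size_pos n
    have : Nonempty (Fin (J.size n)) := ⟨⟨0, hsz⟩⟩
    have hpI : (fun _ : Fin (J.size n) => (J.size n : ℝ)⁻¹) ∈ stdSimplex ℝ (Fin (J.size n)) := by
      simpa using uniform_mem_stdSimplex (U := Fin (J.size n))
    have key := spectrumBelow_marginal_le hpI
      (a := fun w wI => channelPow (fun x y => (P₁ x).1 y) n ((c n).encSD w wI))
      (b := fun w wI => (multihop P.toRelay P₂).destProb (fun _ => ()) ((c n).encSR w wI)
        (c n).relay (J.codeword n wI))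
      (fun w => ⟨fun wI => (isChannel_channelPow hW₁ n).nonneg _,
        fun wI => (isChannel_channelPow hW₁ n).sum_eq_one _⟩)
      (fun w => ⟨fun wI => destProb_nonneg _ _ _ _ _, fun wI => sum_destProb _ _ _ _ _⟩)
      (W := fun w y => P.outputLaw J (c n).toStrategy w
        ((Equiv.arrowProdEquivProdArrow (Fin n) (fun _ => YD₁) (fun _ => YD₂)).symm y))
      (W₂ := (multihop P.toRelay P₂).outputLaw J (s n))
      (fun w y => by
        unfold outputLaw
        rw [mul_sum]
        refine sum_congr rfl fun wI _ => ?_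
        rw [destProb_eq_mul hP]
        rfl)
      (fun w y => by
        unfold outputLaw
        rw [mul_sum])
      (uniform_mem_stdSimplex (U := Fin (k n))) (prod_mem_stdSimplex hQ n)
      (T := 2 ^ ((n : ℝ) * (R - ε'))) (δ := 2 ^ (-((n : ℝ) * ε')))
      (S := 2 ^ ((n : ℝ) * (C + ε'))) (η := V / n)
      (by positivity) (by positivity) (by positivity) (fun w wI => hV n hn _)
    rw [spectrumBelow_comp_equiv] at key
    have hT : ((2 : ℝ) ^ (-((n : ℝ) * ε'))) ^ 2 * 2 ^ ((n : ℝ) * (R - ε')) /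
        2 ^ ((n : ℝ) * (C + ε')) = 2 ^ ((n : ℝ) * (R - C - ε)) := by
      rw [← Real.rpow_natCast, ← Real.rpow_mul zero_le_two, ← Real.rpow_add two_pos,
        ← Real.rpow_sub two_pos]
      congr 1
      simp only [ε']
      push_cast
      ring
    rw [hT] at key
    have h1 := P.spectrumBelow_le_errorProb J (c n) (R := R) (ε := ε') (by simpa using hk n)
    linarith
  refine squeeze_zero' (Eventually.of_forall fun n => spectrumBelow_nonneg
    (isChannel_outputLaw _ J _) uniform_mem_stdSimplex _) hbound ?_
  have h2 := tendsto_two_rpow_neg hε'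
  simpa using ((hc.add h2).add (h2.const_mul 2)).add (tendsto_const_div_atTop_nhds_zero_nat V)

/-- With a single message the likelihood ratio is identically one. -/
theorem isInformationRate_zero [Nonempty XSD] [Nonempty XSR] [Nonempty XR]
    (P : RelayChannel XSD XSR XR XI YR YD) (J : InterfererCodebook XI) :
    P.IsInformationRate J 0 := by
  refine (isInformationRate_iff _ _ _).2 ⟨fun _ => 1, fun _ => ⟨_, uniform_mem_stdSimplex⟩,
    fun n => ⟨fun _ _ _ => Classical.arbitrary _, fun _ _ _ => Classical.arbitrary _,
      fun _ _ => Classical.arbitrary _⟩, fun ε hε => ?_⟩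
  refine tendsto_const_nhds.congr fun n => ?_
  symm
  refine sum_eq_zero fun u _ => sum_eq_zero fun y _ => if_neg ?_
  have hu : u = 0 := Subsingleton.elim _ _
  simp only [outLaw, hu, Fin.sum_univ_one, Fintype.card_fin, Nat.cast_one, inv_one, one_mul,
    not_lt]
  refine mul_le_of_le_one_left ((P.isChannel_outputLaw J _).nonneg _ _) ?_
  refine Real.rpow_le_one_of_one_le_of_nonpos one_le_two ?_
  have : (0 : ℝ) ≤ n := by positivity
  nlinarith

theorem bddAbove_isInformationRate (P : RelayChannel XSD XSR XR XI YR YD)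
    (J : InterfererCodebook XI) : BddAbove {r | P.IsInformationRate J r} := by
  rcases isEmpty_or_nonempty YD with hY | hY
  · refine ⟨0, fun r hr => ?_⟩
    obtain ⟨k, q, s, -⟩ := (isInformationRate_iff _ _ _).1 hr
    exfalso
    have h := (P.isChannel_outputLaw J (s 1))
    have hk : Nonempty (Fin (k 1)) := by
      by_contra hk
      rw [not_nonempty_iff] at hk
      simpa using (q 1).2.2
    simpa using h.sum_eq_one (Classical.arbitrary _)
  · refine ⟨Real.logb 2 (Fintype.card YD) + 1, fun r hr => ?_⟩
    by_contra! hlt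
    obtain ⟨k, q, s, h⟩ := (isInformationRate_iff _ _ _).1 hr
    -- This `ε` turns the threshold into `(2 * card YD) ^ n`, below which the ratio falls with
    -- probability at least `1 - 2 ^ (-n)`.
    have hlim := h (r - (Real.logb 2 (Fintype.card YD) + 1)) (by linarith)
    have hge : ∀ n : ℕ, 1 - (2 : ℝ) ^ (-((n : ℝ) * 1)) ≤
        spectrumBelow (P.outputLaw J (s n)) (q n).1
          (2 ^ ((n : ℝ) * (r - (r - (Real.logb 2 (Fintype.card YD) + 1))))) := fun n => by
      refine le_trans (le_of_eq ?_)
        (one_sub_card_div_le_spectrumBelow (P.isChannel_outputLaw J (s n)) (q n).2 (by positivity))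
      congr 1
      rw [sub_sub_cancel, mul_add, Real.rpow_add two_pos, mul_comm (n : ℝ) (Real.logb _ _),
        Real.rpow_mul zero_le_two, Real.rpow_logb two_pos (by norm_num) (by positivity),
        Fintype.card_fun, Fintype.card_fin, Real.rpow_natCast, Real.rpow_neg zero_le_two]
      push_cast
      field_simp
    have h1 := le_of_tendsto_of_tendsto'
      ((tendsto_two_rpow_neg zero_lt_one).const_sub 1) hlim hge
    norm_num at h1

end RelayChannel

/-! ### The direct part: codes on the two links -/

/-- Rates below the mutual information of an input letter, and the rate zero, are achieved on
a memoryless channel with vanishing maximal error probability. -/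
theorem exists_codes_channelPow {X Y : Type*} [Fintype X] [Fintype Y] {W : X → Y → ℝ}
    (hW : IsChannel W) {p : X → ℝ} (hp : p ∈ stdSimplex ℝ X) {R : ℝ} (hR : 0 ≤ R)
    (hRC : R = 0 ∨ R < mutualInfo (fun x y => p x * W x y)) :
    ∃ (enc : ∀ n, Fin (numMessages n R) → Fin n → X)
      (dec : ∀ n, (Fin n → Y) → Fin (numMessages n R))
      (e : ℕ → ℝ), Tendsto e atTop (nhds 0) ∧
      ∀ n m, ∑ y, (if dec n y = m then 0 else channelPow W n (enc n m) y) ≤ e n := by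
  rcases hRC with rfl | hRC
  · have : Nonempty X := by
      by_contra h
      rw [not_nonempty_iff] at h
      simpa using hp.2
    have : ∀ n, Subsingleton (Fin (numMessages n 0)) := fun n => by
      rw [numMessages_zero]; infer_instance
    exact ⟨fun _ _ _ => Classical.arbitrary X, fun n _ => ⟨0, numMessages_pos n 0⟩, fun _ => 0,
      tendsto_const_nhds, fun n m =>
        (sum_eq_zero fun y _ => if_pos (Subsingleton.elim _ _)).le⟩
  · refine exists_codes_of_spectrumBelow (fun n => isChannel_channelPow hW n)
      (fun n => prod_mem_stdSimplex hp n) hR hRC fun ε hε => ?_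
    obtain ⟨V, hV⟩ := exists_spectrumBelow_channelPow_le hW hp hε
    refine squeeze_zero' (Eventually.of_forall fun n => spectrumBelow_nonneg
      (isChannel_channelPow hW n) (prod_mem_stdSimplex hp n) _) ?_
      (tendsto_const_div_atTop_nhds_zero_nat V)
    filter_upwards [eventually_gt_atTop 0] with n hn using hV n hn

namespace RelayChannel

variable {XSD XSR XR XI YR YD YD₁ YD₂ M : Type*}
variable [Fintype YR] [Fintype YD] [Fintype YD₁] [Fintype YD₂]

/-- Rates below an information rate, and the rate zero, are achieved with vanishing maximal
error probability. -/
theorem exists_strategies [Nonempty XSD] [Nonempty XSR] [Nonempty XR]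
    {P : RelayChannel XSD XSR XR XI YR YD} {J : InterfererCodebook XI} {R : ℝ} (hR : 0 ≤ R)
    (h : R = 0 ∨ ∃ r, R < r ∧ P.IsInformationRate J r) :
    ∃ (s : ∀ n, Strategy XSD XSR XR YR (Fin (numMessages n R)) (J.size n) n)
      (dec : ∀ n, (Fin n → YD) → Fin (numMessages n R)) (e : ℕ → ℝ), Tendsto e atTop (nhds 0) ∧
      ∀ n m, ∑ y, (if dec n y = m then 0 else P.outputLaw J (s n) m y) ≤ e n := by
  rcases h with rfl | ⟨r, hRr, hr⟩
  · have : ∀ n, Subsingleton (Fin (numMessages n 0)) := fun n => by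
      rw [numMessages_zero]; infer_instance
    exact ⟨fun _ => ⟨fun _ _ _ => Classical.arbitrary _, fun _ _ _ => Classical.arbitrary _,
      fun _ _ => Classical.arbitrary _⟩, fun n _ => ⟨0, numMessages_pos n 0⟩, fun _ => 0,
      tendsto_const_nhds, fun n m =>
        (sum_eq_zero fun y _ => if_pos (Subsingleton.elim _ _)).le⟩
  · obtain ⟨k, q, s, hs⟩ := (isInformationRate_iff _ _ _).1 hr
    obtain ⟨enc, dec, e, he, hed⟩ := exists_codes_of_spectrumBelow
      (fun n => P.isChannel_outputLaw J (s n)) (fun n => (q n).2) hR hRr hs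
    exact ⟨fun n => ⟨fun m => (s n).encSD (enc n m), fun m => (s n).encSR (enc n m),
      (s n).relay⟩, dec, e, he, hed⟩

theorem errorProb_nonneg (P : RelayChannel XSD XSR XR XI YR YD) (J : InterfererCodebook XI)
    [Fintype M] [DecidableEq M] {n : ℕ} (c : Code XSD XSR XR YR YD M (J.size n) n) :
    0 ≤ P.errorProb J c := by
  refine mul_nonneg (by positivity) (sum_nonneg fun m _ => sum_nonneg fun y _ => ?_)
  split_ifs
  · exact le_rfl
  · exact (P.isChannel_outputLaw J _).nonneg m y

theorem errorProb_le (P : RelayChannel XSD XSR XR XI YR YD) (J : InterfererCodebook XI)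
    [Fintype M] [DecidableEq M] [Nonempty M] {n : ℕ} (c : Code XSD XSR XR YR YD M (J.size n) n)
    {e : ℝ} (h : ∀ m, ∑ y, (if c.dec y = m then 0 else P.outputLaw J c.toStrategy m y) ≤ e) :
    P.errorProb J c ≤ e := by
  unfold errorProb
  rw [inv_mul_le_iff₀ (by positivity)]
  calc _ ≤ ∑ _m : M, e := sum_le_sum fun m _ => h m
    _ = _ := by simp

theorem achievable_of_forall_le {P : RelayChannel XSD XSR XR XI YR YD}
    {J : InterfererCodebook XI} {R : ℝ} (hR : 0 ≤ R) {e : ℕ → ℝ} (he : Tendsto e atTop (nhds 0))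
    (c : ∀ n, Code XSD XSR XR YR YD (Fin (numMessages n R)) (J.size n) n)
    (h : ∀ n m, ∑ y, (if (c n).dec y = m then 0 else P.outputLaw J (c n).toStrategy m y) ≤ e n) :
    P.Achievable J R := by
  have hne : ∀ n, Nonempty (Fin (numMessages n R)) := fun n => ⟨⟨0, numMessages_pos n R⟩⟩
  exact ⟨hR, c, squeeze_zero (fun n => P.errorProb_nonneg J _)
    (fun n => P.errorProb_le J _ (h n)) he⟩

theorem achievable_of_lt [Nonempty XSD] [Nonempty XSR] [Nonempty XR]
    {P : RelayChannel XSD XSR XR XI YR YD} {J : InterfererCodebook XI} {R : ℝ} (hR : 0 ≤ R)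
    (h : R = 0 ∨ ∃ r, R < r ∧ P.IsInformationRate J r) : P.Achievable J R := by
  obtain ⟨s, dec, e, he, hs⟩ := exists_strategies hR h
  exact achievable_of_forall_le hR he (fun n => { s n with dec := dec n }) hs

/-- Restriction of a code to fewer messages. -/
theorem exists_code_of_card_le (P : RelayChannel XSD XSR XR XI YR YD) (J : InterfererCodebook XI)
    [Fintype M] [DecidableEq M] {n N : ℕ} (hN : 0 < N) (hNM : N ≤ Fintype.card M)
    (c : Code XSD XSR XR YR YD M (J.size n) n) {e : ℝ}
    (h : ∀ m, ∑ y, (if c.dec y = m then 0 else P.outputLaw J c.toStrategy m y) ≤ e) :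
    ∃ c' : Code XSD XSR XR YR YD (Fin N) (J.size n) n,
      ∀ m, ∑ y, (if c'.dec y = m then 0 else P.outputLaw J c'.toStrategy m y) ≤ e := by
  have : Nonempty (Fin N) := ⟨⟨0, hN⟩⟩
  obtain ⟨f⟩ : Nonempty (Fin N ↪ M) := Function.Embedding.nonempty_of_card_le (by simpa using hNM)
  refine ⟨⟨⟨fun m => c.encSD (f m), fun m => c.encSR (f m), c.relay⟩,
    fun y => Function.invFun f (c.dec y)⟩, fun m => le_trans (sum_le_sum fun y _ => ?_) (h (f m))⟩
  have h0 := (P.isChannel_outputLaw J c.toStrategy).nonneg (f m) y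
  change (if Function.invFun f (c.dec y) = m then 0 else P.outputLaw J c.toStrategy (f m) y) ≤ _
  by_cases hd : c.dec y = f m
  · rw [if_pos hd, hd, Function.leftInverse_invFun f.injective, if_pos rfl]
  · rw [if_neg hd]
    split_ifs
    · exact h0
    · exact le_rfl

/-- The rates of independent signalling add up. -/
theorem independentlyAchievable_and_achievable {P : RelayChannel XSD XSR XR XI YR (YD₁ × YD₂)}
    {P₁ : XSD → stdSimplex ℝ YD₁} {P₂ : XR → XI → stdSimplex ℝ YD₂}
    (hP : ∀ xSD xR xI y₁ y₂,
      (P.toDest xSD xR xI).1 (y₁, y₂) = (P₁ xSD).1 y₁ * (P₂ xR xI).1 y₂)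
    {J : InterfererCodebook XI} {R₁ R₂ : ℝ} (hR₁ : 0 ≤ R₁) (hR₂ : 0 ≤ R₂)
    {enc : ∀ n, Fin (numMessages n R₁) → Fin n → XSD}
    {dec₁ : ∀ n, (Fin n → YD₁) → Fin (numMessages n R₁)} {e₁ : ℕ → ℝ}
    (he₁ : Tendsto e₁ atTop (nhds 0))
    (h₁ : ∀ n m, ∑ y, (if dec₁ n y = m then 0
      else channelPow (fun x y => (P₁ x).1 y) n (enc n m) y) ≤ e₁ n)
    {s : ∀ n, Strategy Unit XSR XR YR (Fin (numMessages n R₂)) (J.size n) n}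
    {dec₂ : ∀ n, (Fin n → YD₂) → Fin (numMessages n R₂)} {e₂ : ℕ → ℝ}
    (he₂ : Tendsto e₂ atTop (nhds 0))
    (h₂ : ∀ n m, ∑ y, (if dec₂ n y = m then 0
      else (multihop P.toRelay P₂).outputLaw J (s n) m y) ≤ e₂ n) :
    P.IndependentlyAchievable J R₁ R₂ ∧ P.Achievable J (R₁ + R₂) := by
  have hne₁ : ∀ n, Nonempty (Fin (numMessages n R₁)) := fun n => ⟨⟨0, numMessages_pos n R₁⟩⟩
  have hne₂ : ∀ n, Nonempty (Fin (numMessages n R₂)) := fun n => ⟨⟨0, numMessages_pos n R₂⟩⟩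
  have hW₁ : IsChannel fun x y => (P₁ x).1 y := ⟨fun x => (P₁ x).2.1, fun x => (P₁ x).2.2⟩
  set c : ∀ n, Code XSD XSR XR YR (YD₁ × YD₂)
      (Fin (numMessages n R₁) × Fin (numMessages n R₂)) (J.size n) n := fun n =>
    { encSD := fun w _ => enc n w.1
      encSR := fun w => (s n).encSR w.2
      relay := (s n).relay
      dec := fun y => (dec₁ n (fun i => (y i).1), dec₂ n (fun i => (y i).2)) }
  have hout : ∀ n w y, P.outputLaw J (c n).toStrategy w y =
      channelPow (fun x y => (P₁ x).1 y) n (enc n w.1) (fun i => (y i).1) *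
        (multihop P.toRelay P₂).outputLaw J (s n) w.2 (fun i => (y i).2) := fun n w y => by
    unfold outputLaw
    rw [mul_left_comm]
    congr 1
    rw [mul_sum]
    refine sum_congr rfl fun wI _ => ?_
    rw [destProb_eq_mul hP]
  have hc : ∀ n m, ∑ y, (if (c n).dec y = m then 0 else P.outputLaw J (c n).toStrategy m y) ≤
      e₁ n + e₂ n := fun n m => by
    set a := channelPow (fun x y => (P₁ x).1 y) n (enc n m.1)
    set b := (multihop P.toRelay P₂).outputLaw J (s n) m.2
    have ha0 : ∀ y, 0 ≤ a y := (isChannel_channelPow hW₁ n).nonneg _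
    have hb0 : ∀ y, 0 ≤ b y := (isChannel_outputLaw _ J (s n)).nonneg _
    have ha1 : ∑ y, a y = 1 := (isChannel_channelPow hW₁ n).sum_eq_one _
    have hb1 : ∑ y, b y = 1 := (isChannel_outputLaw _ J (s n)).sum_eq_one _
    rw [← (Equiv.arrowProdEquivProdArrow (Fin n) (fun _ => YD₁) (fun _ => YD₂)).symm.sum_comp,
      Fintype.sum_prod_type]
    -- Union bound over the two decoders; the unaffected factor sums to one.
    calc _ ≤ ∑ y₁, ∑ y₂, ((if dec₁ n y₁ = m.1 then 0 else a y₁) * b y₂ +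
          a y₁ * (if dec₂ n y₂ = m.2 then 0 else b y₂)) := by
          refine sum_le_sum fun y₁ _ => sum_le_sum fun y₂ _ => ?_
          rw [hout]
          change (if (dec₁ n y₁, dec₂ n y₂) = m then 0 else a y₁ * b y₂) ≤ _
          have hab := mul_nonneg (ha0 y₁) (hb0 y₂)
          by_cases hd₁ : dec₁ n y₁ = m.1 <;> by_cases hd₂ : dec₂ n y₂ = m.2 <;>
            simp [Prod.ext_iff, hd₁, hd₂, hab]
      _ = (∑ y, if dec₁ n y = m.1 then 0 else a y) +
          ∑ y, if dec₂ n y = m.2 then 0 else b y := by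
          simp_rw [sum_add_distrib, ← mul_sum, hb1, mul_one, ← sum_mul, ha1, one_mul]
      _ ≤ _ := add_le_add (h₁ n m.1) (h₂ n m.2)
  have he : Tendsto (fun n => e₁ n + e₂ n) atTop (nhds 0) := by simpa using he₁.add he₂
  refine ⟨⟨hR₁, hR₂, c, fun n => ⟨enc n, (s n).encSR, dec₁ n, dec₂ n, fun _ _ => rfl,
    fun _ _ => rfl, fun _ => rfl⟩, squeeze_zero (fun n => P.errorProb_nonneg J _)
    (fun n => P.errorProb_le J _ (hc n)) he⟩, ?_⟩
  -- Discarding surplus message pairs is harmless, since the error bound holds for every single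
  -- pair.
  have hr := fun n => P.exists_code_of_card_le J (numMessages_pos n (R₁ + R₂))
    (by simpa using numMessages_add_le n R₁ R₂) (c n) (hc n)
  choose c' hc' using hr
  exact achievable_of_forall_le (add_nonneg hR₁ hR₂) he c' hc'

/-- Relabelling of the messages of a code. -/
theorem exists_code_errorProb_eq (P : RelayChannel XSD XSR XR XI YR YD)
    (J : InterfererCodebook XI) {M' : Type*} [Fintype M] [DecidableEq M] [Fintype M']
    [DecidableEq M'] (f : M' ≃ M) {n : ℕ} (c : Code XSD XSR XR YR YD M (J.size n) n) :
    ∃ c' : Code XSD XSR XR YR YD M' (J.size n) n, P.errorProb J c' = P.errorProb J c := by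
  refine ⟨⟨⟨fun m => c.encSD (f m), fun m => c.encSR (f m), c.relay⟩,
    fun y => f.symm (c.dec y)⟩, ?_⟩
  unfold errorProb
  rw [Fintype.card_congr f, ← f.sum_comp]
  congr 1
  refine sum_congr rfl fun m _ => sum_congr rfl fun y _ => ?_
  simp only [Equiv.symm_apply_eq]
  rfl

end RelayChannel

end OrthRelay

/-! ### The capacity theorem -/

theorem proposition7
    {XSD XSR XR XI YR YD₁ YD₂ : Type*}
    [Fintype XSD] [Fintype XSR] [Fintype XR] [Fintype XI]
    [Fintype YR] [Fintype YD₁] [Fintype YD₂]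
    [Nonempty XSD] [Nonempty XSR] [Nonempty XR]
    (P : OrthRelay.RelayChannel XSD XSR XR XI YR (YD₁ × YD₂))
    (P₁ : XSD → stdSimplex ℝ YD₁) (P₂ : XR → XI → stdSimplex ℝ YD₂)
    (hP : ∀ xSD xR xI y₁ y₂,
      (P.toDest xSD xR xI).1 (y₁, y₂) = (P₁ xSD).1 y₁ * (P₂ xR xI).1 y₂)
    (J : OrthRelay.InterfererCodebook XI) :
    ∃ C C_SD C_SRD : ℝ,
      -- `C` is the capacity
      IsLUB {R | P.Achievable J R} C ∧
      -- `C_SD = max I(X_SD; Y_D1)`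
      IsGreatest {I | ∃ p : stdSimplex ℝ XSD,
        I = OrthRelay.mutualInfo (fun x y => p.1 x * (P₁ x).1 y)} C_SD ∧
      -- `C_SRD` is the largest rate on the S-R-D link alone, also in multiletter form
      IsLUB {R | (OrthRelay.RelayChannel.multihop P.toRelay P₂).Achievable J R} C_SRD ∧
      IsLUB {r | (OrthRelay.RelayChannel.multihop P.toRelay P₂).IsInformationRate J r} C_SRD ∧
      C = C_SD + C_SRD ∧
      -- independent signalling, with S-D signal independent of the interference, achieves `C`
      IsLUB {R | ∃ R₁ R₂ : ℝ, R = R₁ + R₂ ∧ P.IndependentlyAchievable J R₁ R₂} C := by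
  classical
  have hW₁ : OrthRelay.IsChannel fun x y => (P₁ x).1 y :=
    ⟨fun x => (P₁ x).2.1, fun x => (P₁ x).2.2⟩
  obtain ⟨C_SD, hSD⟩ := OrthRelay.exists_isGreatest_mutualInfo hW₁
  obtain ⟨⟨p, hp⟩, hmax⟩ := hSD
  set mh := OrthRelay.RelayChannel.multihop P.toRelay P₂
  set C_SRD := sSup {r | mh.IsInformationRate J r}
  have hbdd := mh.bddAbove_isInformationRate J
  have hinfo : IsLUB {r | mh.IsInformationRate J r} C_SRD :=
    isLUB_csSup ⟨0, mh.isInformationRate_zero J⟩ hbdd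
  have hSRD0 : 0 ≤ C_SRD := hinfo.1 (mh.isInformationRate_zero J)
  have hmax' : ∀ p' ∈ stdSimplex ℝ XSD,
      OrthRelay.mutualInfo (fun x y => p' x * (P₁ x).1 y) ≤
        OrthRelay.mutualInfo (fun x y => p.1 x * (P₁ x).1 y) := fun p' hp' =>
    (hmax ⟨⟨p', hp'⟩, rfl⟩).trans hp.le
  -- A deterministic input has zero mutual information.
  have hSD0 : 0 ≤ C_SD := by
    obtain ⟨x⟩ := ‹Nonempty XSD›
    refine le_trans (le_of_eq ?_) (hmax ⟨⟨_, single_mem_stdSimplex ℝ x⟩, rfl⟩)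
    symm
    refine Finset.sum_eq_zero fun x' _ => Finset.sum_eq_zero fun y _ => ?_
    rcases eq_or_ne x' x with rfl | hx
    · simp [OrthRelay.infoDensity, Pi.single_apply, (P₁ x').2.2]
      by_cases hz : (P₁ x').1 y = 0 <;> simp [hz]
    · simp [hx]
  have hSRDlt : ∀ R, 0 ≤ R → (R = 0 ∨ R < C_SRD) →
      R = 0 ∨ ∃ r, R < r ∧ mh.IsInformationRate J r := by
    rintro R - (h | h)
    · exact Or.inl h
    · obtain ⟨r, hr, hRr⟩ := exists_lt_of_lt_csSup ⟨0, mh.isInformationRate_zero J⟩ h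
      exact Or.inr ⟨r, hRr, hr⟩
  have hdirect : ∀ R₁ R₂, 0 ≤ R₁ → 0 ≤ R₂ → (R₁ = 0 ∨ R₁ < C_SD) → (R₂ = 0 ∨ R₂ < C_SRD) →
      P.IndependentlyAchievable J R₁ R₂ ∧ P.Achievable J (R₁ + R₂) := by
    intro R₁ R₂ h₁ h₂ h₁' h₂'
    obtain ⟨enc, dec₁, e₁, he₁, hd₁⟩ := OrthRelay.exists_codes_channelPow hW₁ p.2 h₁ (hp ▸ h₁')
    obtain ⟨s, dec₂, e₂, he₂, hd₂⟩ :=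
      OrthRelay.RelayChannel.exists_strategies h₂ (hSRDlt R₂ h₂ h₂')
    exact OrthRelay.RelayChannel.independentlyAchievable_and_achievable hP h₁ h₂ he₁ hd₁ he₂ hd₂
  have hsplit : ∀ b, 0 ≤ b → b < C_SD + C_SRD → ∃ R₁ R₂, b ≤ R₁ + R₂ ∧ 0 ≤ R₁ ∧ 0 ≤ R₂ ∧
      (R₁ = 0 ∨ R₁ < C_SD) ∧ (R₂ = 0 ∨ R₂ < C_SRD) := by
    intro b hb hlt
    set d := (C_SD + C_SRD - b) / 2
    have hd : d = (C_SD + C_SRD - b) / 2 := rfl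
    have hdpos : 0 < d := by linarith
    -- Half of the gap is taken off each link. Truncation at zero covers a link of small or zero
    -- capacity, where rate zero needs its own clause.
    refine ⟨max 0 (C_SD - d), max 0 (C_SRD - d), ?_, le_max_left _ _, le_max_left _ _, ?_, ?_⟩
    · have := le_max_right 0 (C_SD - d)
      have := le_max_right 0 (C_SRD - d)
      linarith
    · rcases max_choice 0 (C_SD - d) with h | h <;> rw [h]
      · exact Or.inl rfl
      · exact Or.inr (by linarith)
    · rcases max_choice 0 (C_SRD - d) with h | h <;> rw [h]
      · exact Or.inl rfl
      · exact Or.inr (by linarith)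
  -- The message count is left general so that the converse covers both ordinary codes and pair
  -- codes, whose size is a product of ceilings.
  have hconv : ∀ (R : ℝ) (k : ℕ → ℕ), (∀ n : ℕ, (2 : ℝ) ^ ((n : ℝ) * R) ≤ k n) →
      ∀ c : ∀ n, OrthRelay.Code XSD XSR XR YR (YD₁ × YD₂) (Fin (k n)) (J.size n) n,
      Filter.Tendsto (fun n => P.errorProb J (c n)) Filter.atTop (nhds 0) →
      R ≤ C_SD + C_SRD := by
    intro R k hk c hc
    have h := OrthRelay.RelayChannel.isInformationRate_multihop_sub hP
      ⟨OrthRelay.outLaw_nonneg hW₁ p.2, OrthRelay.sum_outLaw hW₁ p.2⟩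
      (fun x y hxy => OrthRelay.outLaw_pos_of_isMax hW₁ p.2 hmax' hxy)
      (fun x => (OrthRelay.divergence_outLaw_le_of_isMax hW₁ p.2 hmax' x).trans hp.ge) hk hc
    linarith [hinfo.1 h]
  refine ⟨C_SD + C_SRD, C_SD, C_SRD, ⟨?_, ?_⟩, ⟨⟨p, hp⟩, hmax⟩, ⟨?_, ?_⟩, hinfo, rfl, ?_, ?_⟩
  · rintro R ⟨-, c, hc⟩
    exact hconv R _ (fun n => OrthRelay.two_rpow_le_numMessages n R) c hc
  · intro B hB
    refine le_of_forall_lt fun b hb => ?_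
    obtain ⟨b', hbb', hb'⟩ := exists_between hb
    -- Negative rates are not achievable by definition; rate zero then serves as the lower bound.
    rcases lt_or_ge b' 0 with hneg | hpos
    · have h0 := hB (hdirect 0 0 le_rfl le_rfl (Or.inl rfl) (Or.inl rfl)).2
      linarith
    · obtain ⟨R₁, R₂, hle, h₁, h₂, h₁', h₂'⟩ := hsplit b' hpos hb'
      have := hB (hdirect R₁ R₂ h₁ h₂ h₁' h₂').2
      linarith
  · intro R hR
    exact hinfo.1 (OrthRelay.RelayChannel.isInformationRate_of_achievable hR)
  · intro B hB
    refine le_of_forall_lt fun b hb => ?_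
    obtain ⟨b', hbb', hb'⟩ := exists_between hb
    rcases lt_or_ge b' 0 with hneg | hpos
    · have h0 : (0 : ℝ) ≤ B :=
        hB (OrthRelay.RelayChannel.achievable_of_lt le_rfl (Or.inl rfl))
      linarith
    · have : b' ≤ B := hB (OrthRelay.RelayChannel.achievable_of_lt hpos
        (hSRDlt b' hpos (Or.inr hb')))
      linarith
  · rintro _ ⟨R₁, R₂, rfl, -, -, c, -, hc⟩
    -- The converse makes no use of the independence of the signals, so the pair code is simply
    -- relabelled as an ordinary one.
    choose c' hc' using fun n => P.exists_code_errorProb_eq J finProdFinEquiv.symm (c n)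
    refine hconv (R₁ + R₂) _ (fun n => ?_) c' (by simpa only [hc'] using hc)
    exact (OrthRelay.two_rpow_le_numMessages n _).trans
      (by exact_mod_cast OrthRelay.numMessages_add_le n R₁ R₂)
  · intro B hB
    refine le_of_forall_lt fun b hb => ?_
    obtain ⟨b', hbb', hb'⟩ := exists_between hb
    rcases lt_or_ge b' 0 with hneg | hpos
    · have h0 := hB ⟨0, 0, rfl, (hdirect 0 0 le_rfl le_rfl (Or.inl rfl) (Or.inl rfl)).1⟩
      linarith
    · obtain ⟨R₁, R₂, hle, h₁, h₂, h₁', h₂'⟩ := hsplit b' hpos hb'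
      have := hB ⟨R₁, R₂, rfl, (hdirect R₁ R₂ h₁ h₂ h₁' h₂').1⟩
      linarith
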